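/- Let $m:\mathbb R\to\mathbb R$ be $C^1$ and monotone ($m'\ge 0$ everywhere or $m'\le 0$ everywhere), with $m(0)=0$ and $m(x)\to m_\pm$ as $x\to\pm\infty$, where $m_+,m_-$ are finite and nonzero. For $k\in\mathbb R$ let $$H(k)=k\,\sigma_1-\mathrm i\,\partial_x\,\sigma_2+m(x)\,\sigma_3=\begin{pmatrix} m & k-\partial_x\\ k+\partial_x & -m\end{pmatrix}$$ be the Dirac Hamiltonian on $L^2(\mathbb R;\mathbb C^2)$. A bound eigenstate of $H(k)$ with energy $\omega\in\mathbb R$ is a nonzero square-integrable solution of $H(k)\hat\psi=\omega\hat\psi$. An edge channel is a maximal continuous curve $k\mapsto\omega(k)$ of bound-state energies over an open interval of momenta $k$. Put $\tilde m=\min\{|m_-|,|m_+|\}$ and let $\mu_\epsilon(k)=-\epsilon+\sqrt{k^2+\tilde m^2}$ be the Fermi line, where $\epsilon>0$ is any constant such that $\mu_\epsilon$ lies in the bulk gap, i.e. $|\mu_\epsilon(k)|<\sqrt{k^2+\tilde m^2}$ for all $k$. The intersection number $I(\mu_\epsilon,\omega_j)$ of the Fermi line with a channel $\omega_j$ is the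 sum over their intersection points of $+1$ if, for increasing $k$, $\omega_j$ crosses $\mu_\epsilon$ upwards, $-1$ if it crosses downwards, and $0$ if it touches without crossing. The edge index is $$\mathcal I^\#=-\sum_j I(\mu_\epsilon,\omega_j),$$ the sum being over all edge channels. Then all bound-state energies of $H(k)$ are simple, every bound eigenstate belongs to exactly one edge channel, every channel meets the Fermi line in finitely many points, and $$\mathcal I^\#=\operatorname{sgn}(m'),$$ meaning $\mathcal I^\#=+1$ if $m'\ge0$ and $\mathcal I^\#=-1$ if $m'\le 0$. More precisely: (i) If $m'\ge 0$, there is an edge channel $\omega_L(k)=-k$, $k\in\mathbb R$; its bound eigenstates are exactly the nonzero multiples of $\hat\psi^L(x)=e^{-\int_0^x m(t)\,dt}\binom{1}{-1}$; $I(\mu_\epsilon,\omega_L)=-1$, and $I(\mu_\epsilon,\omega_j)=0$ for every other channel. (ii) If $m'\le 0$, there is an edge channel $\omega_R(k)=k$, $k\in\mathbb R$; its bound eigenstates are exactly the nonzero multiples of $\hat\psi^R(x)=e^{\int_0^x m(t)\,dt}\binom{1}{1}$; $I(\mu_\epsilon,\omega_R)=+1$, and $I(\mu_\epsilon,\omega_j)=0$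 for every other channel. Moreover, if $m'\ge0$, then $\mathcal I=\mathcal I^\#=1$. Here the bulk index $\mathcal I$ is the Chern number of the line bundle over $S^2$ that is the range of the projections $P_\pm(k_1,k_2)=\frac12\bigl(1+(k_1^2+k_2^2+m_\pm^2)^{-1/2}(k_1,k_2,m_\pm)\cdot\vec\sigma\bigr)$ on two copies of $\mathbb R^2$, which are compactified to closed disks and glued along their boundary circles at infinity, where $P_+=P_-$, the second copy having reversed orientation; the Chern number is $$\mathcal I=\frac1{2\pi \mathrm i}\int_{\mathbb R^2}\operatorname{tr}\bigl(P_+[\partial_1P_+,\partial_2P_+]\bigr)\,dk-\frac1{2\pi \mathrm i}\int_{\mathbb R^2}\operatorname{tr}\bigl(P_-[\partial_1P_-,\partial_2P_-]\bigr)\,dk .$$ -/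

import Mathlib

open Set Filter Topology MeasureTheory

noncomputable section

namespace DiracInterface

/-! ### Pauli matrices and the fibered Hamiltonian -/

/-- The Pauli matrix `σ₁`. -/
def pauli1 : Matrix (Fin 2) (Fin 2) ℂ := !![0, 1; 1, 0]

/-- The Pauli matrix `σ₂`. -/
def pauli2 : Matrix (Fin 2) (Fin 2) ℂ := !![0, -Complex.I; Complex.I, 0]

/-- The Pauli matrix `σ₃`. -/
def pauli3 : Matrix (Fin 2) (Fin 2) ℂ := !![1, 0; 0, -1]

/-- The fiber `H(k) = (k, -i ∂, m) · σ` of the Dirac Hamiltonian with mass profile `m`, at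
longitudinal momentum `k`, acting on differentiable spinors of the transversal coordinate. -/
def diracFiber (m : ℝ → ℝ) (k : ℝ) (ψ : ℝ → Fin 2 → ℂ) (x : ℝ) : Fin 2 → ℂ :=
  (k : ℂ) • (pauli1.mulVec (ψ x)) + pauli2.mulVec ((-Complex.I) • deriv ψ x)
    + (m x : ℂ) • (pauli3.mulVec (ψ x))

/-- `ψ` is a bound eigenstate of `H(k)` with energy `ω`: a nonzero square-integrable solution of
`H(k) ψ = ω ψ`. (For a continuous bounded `m` every eigenfunction of the self-adjoint operator
`H(k)`, whose domain is `H¹(ℝ; ℂ²)`, is of this kind, and conversely.) -/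
structure IsBoundState (m : ℝ → ℝ) (k ω : ℝ) (ψ : ℝ → Fin 2 → ℂ) : Prop where
  differentiable : Differentiable ℝ ψ
  memLp : MemLp ψ 2 volume
  ne_zero : ψ ≠ 0
  eigen : ∀ x, diracFiber m k ψ x = (ω : ℂ) • ψ x

/-- The spinor `x ↦ exp (- ∫₀ˣ m) (1, -1)` (the left-mover, up to normalization). -/
def psiL (m : ℝ → ℝ) (x : ℝ) : Fin 2 → ℂ :=
  (Real.exp (-∫ t in (0 : ℝ)..x, m t) : ℂ) • ![1, -1]

/-- The spinor `x ↦ exp (∫₀ˣ m) (1, 1)` (the right-mover, up to normalization). -/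
def psiR (m : ℝ → ℝ) (x : ℝ) : Fin 2 → ℂ :=
  (Real.exp (∫ t in (0 : ℝ)..x, m t) : ℂ) • ![1, 1]

/-! ### Edge channels -/

/-- `w` is a continuous branch of bound-state energies over the open interval `D` of momenta. -/
structure IsBranch (m : ℝ → ℝ) (D : Set ℝ) (w : ℝ → ℝ) : Prop where
  isOpen : IsOpen D
  nonempty : D.Nonempty
  ordConnected : D.OrdConnected
  continuousOn : ContinuousOn w D
  bound : ∀ k ∈ D, ∃ ψ, IsBoundState m k (w k) ψ

/-- An edge channel: a maximal continuous branch `k ↦ ω(k)` of bound-state energies.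
The function `energy` is only meaningful on `dom`; it is set to `0` elsewhere so that a channel is
determined by its graph over `dom`. -/
@[ext]
structure EdgeChannel (m : ℝ → ℝ) where
  dom : Set ℝ
  energy : ℝ → ℝ
  isBranch : IsBranch m dom energy
  maximal : ∀ (D : Set ℝ) (w : ℝ → ℝ), IsBranch m D w → dom ⊆ D → EqOn energy w dom → D = dom
  energy_off : ∀ k, k ∉ dom → energy k = 0

/-! ### Fermi line, intersection numbers and the edge index -/

/-- `m̃ = min (|m₋|, |m₊|)`. -/
def massGap (mMinus mPlus : ℝ) : ℝ := min |mMinus| |mPlus|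

/-- The bulk gap of `H(k)`, i.e. the complement of its essential spectrum
`{ω : |ω| ≥ √(k² + m̃²)}`. -/
def bulkGap (mMinus mPlus k : ℝ) : Set ℝ :=
  {ω | |ω| < Real.sqrt (k ^ 2 + massGap mMinus mPlus ^ 2)}

/-- The fiducial (Fermi) line `μ_ε(k) = -ε + √(k² + m̃²)`. -/
def fermiLine (mMinus mPlus ε k : ℝ) : ℝ :=
  -ε + Real.sqrt (k ^ 2 + massGap mMinus mPlus ^ 2)

open Classical in
/-- Local intersection number, over the momentum `k`, of the curves `μ` and `w` in the
`(k, ω)`-plane, both run through in the direction of increasing `k`: it is `+1` if `w` crosses `μ`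
from below to above, `-1` if `w` crosses `μ` from above to below, and `0` if `w` touches `μ` without
crossing it. At a transversal crossing this is the sign of
`w'(k) - μ'(k) = det ((1, μ'(k)), (1, w'(k)))`; the `k`-axis and the `ω`-axis, in this order, have
intersection number `+1`. -/
def localIntersection (μ w : ℝ → ℝ) (k : ℝ) : ℤ :=
  if (∀ᶠ x in 𝓝[<] k, w x < μ x) ∧ (∀ᶠ x in 𝓝[>] k, μ x < w x) then 1
  else if (∀ᶠ x in 𝓝[<] k, μ x < w x) ∧ (∀ᶠ x in 𝓝[>] k, w x < μ x) then -1
  else 0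

/-- The momenta at which a channel meets the line `μ`. -/
def EdgeChannel.meeting {m : ℝ → ℝ} (c : EdgeChannel m) (μ : ℝ → ℝ) : Set ℝ :=
  {k | k ∈ c.dom ∧ c.energy k = μ k}

/-- The intersection number `I(μ, ω_c)` of the line `μ` with the edge channel `c`: the sum of the
local intersection numbers over all intersection points. -/
def intersectionNumber {m : ℝ → ℝ} (μ : ℝ → ℝ) (c : EdgeChannel m) : ℤ :=
  ∑ᶠ k ∈ c.meeting μ, localIntersection μ c.energy k

/-- The edge index: minus the sum over all edge channels of their intersection numbers with the
Fermi line. -/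
def edgeIndex (m : ℝ → ℝ) (mMinus mPlus ε : ℝ) : ℤ :=
  -∑ᶠ c : EdgeChannel m, intersectionNumber (fermiLine mMinus mPlus ε) c

/-! ### The compactified Brillouin zone and the bulk index -/

/-- The sphere `S²`, the compactified Brillouin zone. -/
abbrev BrillouinSphere : Type := Metric.sphere (0 : EuclideanSpace ℝ (Fin 3)) 1

/-- The point of `ℝ³` above the momentum `k` in the hemisphere with sign `s`. -/
def hemispherePoint (s : ℤˣ) (k : ℝ × ℝ) : EuclideanSpace ℝ (Fin 3) :=
  (Real.sqrt (1 + k.1 ^ 2 + k.2 ^ 2))⁻¹ • !₂[k.1, k.2, ((s : ℤ) : ℝ)]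

lemma norm_hemispherePoint (s : ℤˣ) (k : ℝ × ℝ) : ‖hemispherePoint s k‖ = 1 := by
  have hpos : 0 < 1 + k.1 ^ 2 + k.2 ^ 2 := by positivity
  have hs : (((s : ℤ) : ℝ)) ^ 2 = 1 := by
    rcases Int.units_eq_one_or s with rfl | rfl <;> simp
  have hn : ‖(!₂[k.1, k.2, ((s : ℤ) : ℝ)] : EuclideanSpace ℝ (Fin 3))‖
      = Real.sqrt (1 + k.1 ^ 2 + k.2 ^ 2) := by
    rw [EuclideanSpace.norm_eq]
    congr 1
    simp only [Fin.sum_univ_three, Real.norm_eq_abs, sq_abs]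
    simp [hs]
    ring
  rw [hemispherePoint, norm_smul, hn, norm_inv, Real.norm_eq_abs, abs_of_nonneg (Real.sqrt_nonneg _)]
  exact inv_mul_cancel₀ (Real.sqrt_ne_zero'.mpr hpos)

/-- The two Brillouin planes as open hemispheres of `S²`: the plane with sign `s = ±1` is embedded by
`(k₁, k₂) ↦ (k₁, k₂, s) / √(1 + k₁² + k₂²)`; a ray going to infinity in direction `θ` ends at the
same point `θ` of the equator in both planes. For the outward orientation of `S²` the embedding
preserves orientation if `s = 1` and reverses it if `s = -1`. -/
def hemisphereChart (s : ℤˣ) (k : ℝ × ℝ) : BrillouinSphere :=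
  ⟨hemispherePoint s k, by simp [norm_hemispherePoint]⟩

/-- `d · σ` for a real vector `d`. -/
def dotPauli (d : Fin 3 → ℝ) : Matrix (Fin 2) (Fin 2) ℂ :=
  (d 0 : ℂ) • pauli1 + (d 1 : ℂ) • pauli2 + (d 2 : ℂ) • pauli3

/-- The vector `d(q) = (q₁, q₂, m₊ max(q₃, 0) + m₋ max(-q₃, 0))` on the sphere. At the point
over `k` of the hemisphere with sign `±` it is a positive multiple of `(k₁, k₂, m_±)`, the vector of
the asymptotic Hamiltonian `H_±(k) = (k₁, k₂, m_±) · σ`; on the equator it is the common limit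
`(q₁, q₂, 0)` of the directions of both. -/
def bulkVector (mMinus mPlus : ℝ) (q : BrillouinSphere) : Fin 3 → ℝ :=
  ![q.1 0, q.1 1, mPlus * max (q.1 2) 0 + mMinus * max (-(q.1 2)) 0]

/-- The projection `P(q) = (1 + e(q) · σ) / 2`, `e = d / |d|`, glued from the projections `P_±` onto
the positive bands of `H_±`. Its range at `q` is the fiber of the Bloch bundle `ℰ` over `S²`. -/
def blochProjection (mMinus mPlus : ℝ) (q : BrillouinSphere) : Matrix (Fin 2) (Fin 2) ℂ :=
  (1 / 2 : ℂ) • (1 + dotPauli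
    ((Real.sqrt (∑ i, bulkVector mMinus mPlus q i ^ 2))⁻¹ • bulkVector mMinus mPlus q))

/-- `tr (P [∂₁P, ∂₂P])` for a family `P` of matrices over the plane. -/
def curvature (P : ℝ × ℝ → Matrix (Fin 2) (Fin 2) ℂ) (k : ℝ × ℝ) : ℂ :=
  let D1 : Matrix (Fin 2) (Fin 2) ℂ := Matrix.of fun i j => deriv (fun t => P (t, k.2) i j) k.1
  let D2 : Matrix (Fin 2) (Fin 2) ℂ := Matrix.of fun i j => deriv (fun t => P (k.1, t) i j) k.2
  (P k * (D1 * D2 - D2 * D1)).trace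

/-- The Chern number `(2πi)⁻¹ ∫ tr (P [∂₁P, ∂₂P])` of the bundle `q ↦ ran P(q)` over the oriented
sphere, the integral being evaluated in the charts of the two hemispheres (which miss only the
equator), with a minus sign for the orientation reversing one. -/
def chernNumber (P : BrillouinSphere → Matrix (Fin 2) (Fin 2) ℂ) : ℂ :=
  (2 * (Real.pi : ℂ) * Complex.I)⁻¹ *
    ((∫ k : ℝ × ℝ, curvature (fun k => P (hemisphereChart 1 k)) k)
      - ∫ k : ℝ × ℝ, curvature (fun k => P (hemisphereChart (-1) k)) k)

/-- The bulk index: the Chern number of the Bloch bundle over the compactified Brillouin zone. -/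
def bulkIndex (mMinus mPlus : ℝ) : ℂ := chernNumber (blochProjection mMinus mPlus)

end DiracInterface

end

noncomputable section

namespace DiracInterface

/-! ### The Dirac system in the chiral basis -/

/-! In the basis a = ψ₁ + ψ₂, b = ψ₁ - ψ₂ the momentum and the energy enter only through p = ω + k
and q = ω - k, and the whole spectrum can be described without solving the equation. Take m
increasing. If p = 0, then a = 0, b = exp(-∫m) is a bound state, because m changes sign from
negative to positive: this is the branch ω = -k. If p ≠ 0, rescaling b turns (p, q) into (1, pq), so
only E = pq = ω² - k² matters, and E is an eigenvalue of the supersymmetric operator (∂ + m)(-∂ +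
m). Such E are positive, since the kernel a' = m a has no square-integrable solution, and they form
a countable set S, since eigenfunctions for different E are orthogonal in a separable space
(`hasChiralSolution_iff`, `pos_of_mem_chiralSpectrum`, `countable_chiralSpectrum`).

Along a continuous branch ω² - k² is continuous with values in the countable set S ∪ {0}, hence
constant. So the channels are exactly ω = -k and ω = ±√(k² + E), all defined on ℝ and pairwise
disjoint (`exists_curve_eqOn`, `curve_unique`). The hyperbolas are even, like the Fermi line, so
their crossings at k and -k cancel; the line ω = -k crosses once, downwards. A decreasing m reduces
to -m by exchanging a and b, which turns ω = -k into ω = k.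

For the bulk index, the curvature of each plane is explicit and integrates in polar coordinates to
πi sgn(m_±); with m_- < 0 < m_+ the difference is 2πi. -/

/-- A square-integrable solution of `a' = m a - p b`, `b' = -m b + q a`. In the chiral basis
`a = ψ₁ + ψ₂`, `b = ψ₁ - ψ₂` the equation `H(k) ψ = ω ψ` has this form, with `p = ω + k` and
`q = ω - k`. -/
structure IsChiralSolution (m : ℝ → ℝ) (p q : ℝ) (a b : ℝ → ℂ) : Prop where
  deriv_fst : ∀ x, HasDerivAt a (m x * a x - p * b x) x
  deriv_snd : ∀ x, HasDerivAt b (-(m x * b x) + q * a x) x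
  memLp_fst : MemLp a 2 volume
  memLp_snd : MemLp b 2 volume

/-- A mass profile which changes sign from negative to positive at `0`, and which is bounded, and
bounded away from zero near infinity. -/
structure IsKink (m : ℝ → ℝ) : Prop where
  continuous : Continuous m
  bounded : ∃ C, 0 ≤ C ∧ ∀ x, |m x| ≤ C
  nonneg : ∀ x, 0 ≤ x → 0 ≤ m x
  nonpos : ∀ x, x ≤ 0 → m x ≤ 0
  away : ∃ δ > 0, ∃ R ≥ 0, (∀ x, R ≤ x → δ ≤ m x) ∧ ∀ x, x ≤ -R → m x ≤ -δ

/-- Since m(0) = 0 lies between the two nonzero limits, these have opposite signs; half of each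
limit serves as the bound away from zero. -/
lemma isKink_of_monotone {m : ℝ → ℝ} {mMinus mPlus : ℝ} (hc : Continuous m) (hm0 : m 0 = 0)
    (hbot : Tendsto m atBot (𝓝 mMinus)) (htop : Tendsto m atTop (𝓝 mPlus))
    (hMinus : mMinus ≠ 0) (hPlus : mPlus ≠ 0) (hmono : Monotone m) : IsKink m := by
  have hle : ∀ x, m x ≤ mPlus := fun x => hmono.ge_of_tendsto htop x
  have hge : ∀ x, mMinus ≤ m x := fun x => hmono.le_of_tendsto hbot x
  have hp : 0 < mPlus := lt_of_le_of_ne (hm0 ▸ hle 0) hPlus.symm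
  have hn : mMinus < 0 := lt_of_le_of_ne (hm0 ▸ hge 0) hMinus
  refine ⟨hc, ⟨max mPlus (-mMinus), le_max_of_le_left hp.le, fun x => ?_⟩, fun x hx => ?_,
    fun x hx => ?_, ?_⟩
  · rw [abs_le]
    constructor
    · linarith [hge x, le_max_right mPlus (-mMinus)]
    · exact (hle x).trans (le_max_left _ _)
  · simpa [hm0] using hmono hx
  · simpa [hm0] using hmono hx
  · obtain ⟨r, hr⟩ := eventually_atTop.1 (htop.eventually_const_lt (half_lt_self hp))
    obtain ⟨r', hr'⟩ := eventually_atBot.1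
      (hbot.eventually_lt_const (show mMinus < mMinus / 2 by linarith))
    refine ⟨min (mPlus / 2) (-mMinus / 2), lt_min (by linarith) (by linarith),
      max 0 (max r (-r')), le_max_left _ _, fun x hx => ?_, fun x hx => ?_⟩
    · exact (min_le_left _ _).trans
        (hr x (((le_max_left _ _).trans (le_max_right _ _)).trans hx)).le
    · have h1 : -r' ≤ max 0 (max r (-r')) := (le_max_right _ _).trans (le_max_right _ _)
      have h2 := hr' x (by linarith)
      have h3 := min_le_right (mPlus / 2) (-mMinus / 2)
      linarith

/-- A rough bound for the growth of the primitive of a profile bounded away from zero. -/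
lemma linear_le_integral {f : ℝ → ℝ} (hf : Continuous f) {δ R : ℝ} (hR : 0 ≤ R)
    (h0 : ∀ x, 0 ≤ x → 0 ≤ f x) (h : ∀ x, R ≤ x → δ ≤ f x) {x : ℝ} (hx : R ≤ x) :
    δ * (x - R) ≤ ∫ t in (0 : ℝ)..x, f t := by
  rw [← intervalIntegral.integral_add_adjacent_intervals (hf.intervalIntegrable 0 R)
    (hf.intervalIntegrable R x)]
  have h1 : 0 ≤ ∫ t in (0 : ℝ)..R, f t :=
    intervalIntegral.integral_nonneg hR fun u hu => h0 u hu.1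
  have h2 : ∫ _ in R..x, δ ≤ ∫ t in R..x, f t :=
    intervalIntegral.integral_mono_on hx (by simp) (hf.intervalIntegrable R x)
      fun u hu => h u hu.1
  simp only [intervalIntegral.integral_const, smul_eq_mul] at h2
  linarith

lemma hasDerivAt_primitive {m : ℝ → ℝ} (hm : Continuous m) (x : ℝ) :
    HasDerivAt (fun y => ∫ t in (0 : ℝ)..y, m t) (m x) x :=
  intervalIntegral.integral_hasDerivAt_right (hm.intervalIntegrable 0 x)
    (hm.stronglyMeasurableAtFilter _ _) hm.continuousAt

/-! ### Decay of the zero mode -/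

namespace IsKink

variable {m : ℝ → ℝ}

lemma integral_nonneg (hm : IsKink m) (x : ℝ) : 0 ≤ ∫ t in (0 : ℝ)..x, m t := by
  rcases le_total 0 x with hx | hx
  · exact intervalIntegral.integral_nonneg hx fun u hu => hm.nonneg u hu.1
  · rw [intervalIntegral.integral_symm, ← intervalIntegral.integral_neg]
    exact intervalIntegral.integral_nonneg hx fun u hu => neg_nonneg.2 (hm.nonpos u hu.2)

lemma integrableOn_exp (hf : Continuous m) {δ R : ℝ} (hδ : 0 < δ) (hR : 0 ≤ R)
    (h0 : ∀ x, 0 ≤ x → 0 ≤ m x) (h : ∀ x, R ≤ x → δ ≤ m x) :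
    IntegrableOn (fun x => Real.exp (-∫ t in (0 : ℝ)..x, m t) ^ 2) (Ioi 0) := by
  have hcont : Continuous fun x => ∫ t in (0 : ℝ)..x, m t :=
    continuous_iff_continuousAt.2 fun x => (hasDerivAt_primitive hf x).continuousAt
  refine integrable_of_isBigO_exp_neg (b := 2 * δ) (by positivity) (by fun_prop) ?_
  -- From ∫m ≥ δ(x - R): the square is at most exp(2δR) exp(-2δx).
  refine Asymptotics.IsBigO.of_bound (Real.exp (2 * (δ * R))) ?_
  filter_upwards [eventually_ge_atTop R] with x hx
  have := linear_le_integral hf hR h0 h hx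
  rw [Real.norm_eq_abs, Real.norm_eq_abs, abs_of_pos (by positivity), Real.abs_exp,
    ← Real.exp_add, ← Real.exp_nat_mul]
  apply Real.exp_le_exp.2
  push_cast
  nlinarith

/-- The left half-line reduces to the right one by the reflection m ↦ -m(-x), which preserves kinks
and reflects the primitive. -/
lemma memLp_exp (hm : IsKink m) :
    MemLp (fun x => ((Real.exp (-∫ t in (0 : ℝ)..x, m t) : ℝ) : ℂ)) 2 volume := by
  have hcont : Continuous fun x => ∫ t in (0 : ℝ)..x, m t :=
    continuous_iff_continuousAt.2 fun x => (hasDerivAt_primitive hm.continuous x).continuousAt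
  obtain ⟨δ, hδ, R, hR, hp, hn⟩ := hm.away
  have h := integrableOn_exp (m := fun x => -m (-x)) (hm.continuous.comp continuous_neg).neg hδ hR
    (fun x hx => neg_nonneg.2 (hm.nonpos _ (by linarith)))
    (fun x hx => by have := hn (-x) (by linarith); linarith)
  have hrefl : ∀ x : ℝ, ∫ t in (0 : ℝ)..(-x), -m (-t) = ∫ t in (0 : ℝ)..x, m t := fun x => by
    rw [intervalIntegral.integral_neg, intervalIntegral.integral_comp_neg fun t => m t,
      intervalIntegral.integral_symm]
    simp
  have hleft : IntegrableOn (fun x => Real.exp (-∫ t in (0 : ℝ)..x, m t) ^ 2) (Iio 0) := by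
    rw [← neg_zero] at h
    have h' := h.comp_neg_Iio
    simpa only [neg_zero, hrefl] using h'
  have hint : Integrable fun x => Real.exp (-∫ t in (0 : ℝ)..x, m t) ^ 2 := by
    rw [← integrableOn_univ, ← Iic_union_Ioi (a := (0 : ℝ))]
    exact ((integrableOn_Iic_iff_integrableOn_Iio (by finiteness)).2 hleft).union
      (integrableOn_exp hm.continuous hδ hR hm.nonneg hp)
  have hmeas : AEStronglyMeasurable (fun x => Real.exp (-∫ t in (0 : ℝ)..x, m t)) volume :=
    (Real.continuous_exp.comp hcont.neg).aestronglyMeasurable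
  exact ((memLp_two_iff_integrable_sq hmeas).2 hint).ofReal

end IsKink

/-! ### Symmetries, uniqueness and integral identities -/

namespace IsChiralSolution

variable {m : ℝ → ℝ} {p q p' q' : ℝ} {a b a' b' : ℝ → ℂ}

/-- Lets the decreasing profile be treated as the increasing profile `-m`. -/
lemma swap (h : IsChiralSolution m p q a b) : IsChiralSolution (-m) q p b (-a) where
  deriv_fst x := by
    exact (h.deriv_snd x).congr_deriv (by
      simp)
  deriv_snd x := by
    exact ((h.deriv_fst x).neg).congr_deriv (by
      simp; ring)
  memLp_fst := h.memLp_snd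
  memLp_snd := h.memLp_fst.neg

lemma conj (h : IsChiralSolution m p q a b) :
    IsChiralSolution m p q (fun x => star (a x)) (fun x => star (b x)) where
  deriv_fst x := by
    exact ((h.deriv_fst x).star).congr_deriv (by
      simp)
  deriv_snd x := by
    exact ((h.deriv_snd x).star).congr_deriv (by
      simp)
  memLp_fst := h.memLp_fst.star
  memLp_snd := h.memLp_snd.star

/-- The product pq is invariant, so for p ≠ 0 it is the only spectral parameter. -/
lemma scale (h : IsChiralSolution m p q a b) {c : ℝ} (hc : c ≠ 0) :
    IsChiralSolution m (p / c) (c * q) a (fun x => c * b x) where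
  deriv_fst x := by
    exact (h.deriv_fst x).congr_deriv (by
      have : (c : ℂ) ≠ 0 := by exact_mod_cast hc
      push_cast
      field_simp)
  deriv_snd x := by
    exact ((h.deriv_snd x).const_mul (c : ℂ)).congr_deriv (by
      push_cast
      ring)
  memLp_fst := h.memLp_fst
  memLp_snd := h.memLp_snd.const_mul _

lemma sub_smul (h : IsChiralSolution m p q a b) (h' : IsChiralSolution m p q a' b') (c : ℂ) :
    IsChiralSolution m p q (fun x => a' x - c * a x) (fun x => b' x - c * b x) where
  deriv_fst x := by
    exact ((h'.deriv_fst x).sub ((h.deriv_fst x).const_mul c)).congr_deriv (by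
      ring)
  deriv_snd x := by
    exact ((h'.deriv_snd x).sub ((h.deriv_snd x).const_mul c)).congr_deriv (by
      ring)
  memLp_fst := h'.memLp_fst.sub (h.memLp_fst.const_mul c)
  memLp_snd := h'.memLp_snd.sub (h.memLp_snd.const_mul c)

lemma continuous_fst (h : IsChiralSolution m p q a b) : Continuous a :=
  continuous_iff_continuousAt.2 fun x => (h.deriv_fst x).continuousAt

lemma continuous_snd (h : IsChiralSolution m p q a b) : Continuous b :=
  continuous_iff_continuousAt.2 fun x => (h.deriv_snd x).continuousAt

lemma eq_zero_of_initial (h : IsChiralSolution m p q a b) (hm : ∃ C, 0 ≤ C ∧ ∀ x, |m x| ≤ C)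
    (x₀ : ℝ) (ha : a x₀ = 0) (hb : b x₀ = 0) : a = 0 ∧ b = 0 := by
  obtain ⟨C, hC, hm⟩ := hm
  have key : (fun x => (a x, b x)) = fun _ => (0, 0) := by
    refine ODE_solution_unique_univ
      (v := fun t (y : ℂ × ℂ) => (m t * y.1 - p * y.2, -(m t * y.2) + q * y.1))
      -- A crude Lipschitz constant for both components in the sup norm.
      (K := Real.toNNReal (C + |p| + |q|)) (s := fun _ => univ) (t₀ := x₀)
      (fun t => LipschitzOnWith.of_dist_le_mul fun y _ z _ => ?_)
      (fun t => ⟨(h.deriv_fst t).prodMk (h.deriv_snd t), mem_univ _⟩)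
      (fun t => ⟨(hasDerivAt_const t ((0 : ℂ), (0 : ℂ))).congr_deriv (by simp; rfl), mem_univ _⟩)
      (by simp [ha, hb])
    rw [Real.coe_toNNReal _ (by positivity), dist_eq_norm, dist_eq_norm]
    have h1 : ‖(y - z).1‖ ≤ ‖y - z‖ := norm_fst_le _
    have h2 : ‖(y - z).2‖ ≤ ‖y - z‖ := norm_snd_le _
    have hmt := hm t
    have hn := norm_nonneg (y - z)
    rw [Prod.norm_def]
    refine max_le ?_ ?_
    · have : ((m t * y.1 - p * y.2, -(m t * y.2) + q * y.1) -
          (m t * z.1 - p * z.2, -(m t * z.2) + q * z.1) : ℂ × ℂ).1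
          = m t * (y - z).1 - p * (y - z).2 := by simp; ring
      rw [this]
      refine (norm_sub_le _ _).trans ?_
      rw [norm_mul, norm_mul, Complex.norm_real, Complex.norm_real, Real.norm_eq_abs,
        Real.norm_eq_abs]
      have := mul_le_mul hmt h1 (norm_nonneg _) hC
      have := mul_le_mul_of_nonneg_left h2 (abs_nonneg p)
      have := mul_nonneg (abs_nonneg q) hn
      linarith
    · have : ((m t * y.1 - p * y.2, -(m t * y.2) + q * y.1) -
          (m t * z.1 - p * z.2, -(m t * z.2) + q * z.1) : ℂ × ℂ).2
          = q * (y - z).1 - m t * (y - z).2 := by simp; ring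
      rw [this]
      refine (norm_sub_le _ _).trans ?_
      rw [norm_mul, norm_mul, Complex.norm_real, Complex.norm_real, Real.norm_eq_abs,
        Real.norm_eq_abs]
      have := mul_le_mul hmt h2 (norm_nonneg _) hC
      have := mul_le_mul_of_nonneg_left h1 (abs_nonneg q)
      have := mul_nonneg (abs_nonneg p) hn
      linarith
  exact ⟨funext fun x => congrArg Prod.fst (congrFun key x),
    funext fun x => congrArg Prod.snd (congrFun key x)⟩

/-- Integrating `(a b')' = q' a a' - p b b'`. -/
lemma mul_integral_eq (h : IsChiralSolution m p q a b) (h' : IsChiralSolution m p' q' a' b') :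
    (p : ℂ) * ∫ x, b x * b' x = q' * ∫ x, a x * a' x := by
  have hbb : Integrable fun x => b x * b' x := h.memLp_snd.integrable_mul h'.memLp_snd
  have haa : Integrable fun x => a x * a' x := h.memLp_fst.integrable_mul h'.memLp_fst
  have hab : Integrable fun x => a x * b' x := h.memLp_fst.integrable_mul h'.memLp_snd
  -- The mass terms cancel in the product rule, and the derivative of an integrable function has
  -- integral zero.
  have key := integral_eq_zero_of_hasDerivAt_of_integrable (f := fun x => a x * b' x)
    (f' := fun x => q' * (a x * a' x) - p * (b x * b' x)) (fun x => by
      exact ((h.deriv_fst x).mul (h'.deriv_snd x)).congr_deriv (by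
        ring)) ((haa.const_mul _).sub (hbb.const_mul _)) hab
  rw [integral_sub (haa.const_mul _) (hbb.const_mul _), integral_const_mul,
    integral_const_mul, sub_eq_zero] at key
  exact key.symm

/-- The Wronskian of two square-integrable solutions vanishes. -/
lemma wronskian_eq_zero (h : IsChiralSolution m p q a b) (h' : IsChiralSolution m p q a' b')
    (x : ℝ) : a x * b' x - a' x * b x = 0 := by
  -- The system is trace-free, so the Wronskian is constant; being integrable on a line of infinite
  -- measure, it is zero.
  have hder : ∀ x, HasDerivAt (fun x => a x * b' x - a' x * b x) 0 x := fun x => by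
    exact (((h.deriv_fst x).mul (h'.deriv_snd x)).sub ((h'.deriv_fst x).mul (h.deriv_snd x))).congr_deriv (by
      ring)
  have hint : Integrable fun x => a x * b' x - a' x * b x :=
    (h.memLp_fst.integrable_mul h'.memLp_snd).sub (h'.memLp_fst.integrable_mul h.memLp_snd)
  have hconst : (fun x => a x * b' x - a' x * b x) = fun _ => a x * b' x - a' x * b x :=
    funext fun y => is_const_of_deriv_eq_zero (fun z => (hder z).differentiableAt)
      (fun z => (hder z).deriv) y x
  rw [hconst, integrable_const_iff] at hint
  rcases hint with h0 | h0
  · exact h0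
  · exact absurd h0.measure_univ_lt_top (by simp)

/-- The vanishing Wronskian makes the initial data at 0 proportional, and uniqueness for the ODE
propagates the factor. -/
lemma exists_eq_smul (h : IsChiralSolution m p q a b) (h' : IsChiralSolution m p q a' b')
    (hm : ∃ C, 0 ≤ C ∧ ∀ x, |m x| ≤ C) (h0 : a ≠ 0 ∨ b ≠ 0) :
    ∃ c : ℂ, (∀ x, a' x = c * a x) ∧ ∀ x, b' x = c * b x := by
  have hW := h.wronskian_eq_zero h' 0
  have hc : ∃ c : ℂ, a' 0 - c * a 0 = 0 ∧ b' 0 - c * b 0 = 0 := by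
    by_cases ha : a 0 = 0
    · by_cases hb : b 0 = 0
      · obtain ⟨h1, h2⟩ := h.eq_zero_of_initial hm 0 ha hb
        simp [h1, h2] at h0
      · refine ⟨b' 0 / b 0, ?_, ?_⟩
        · have : a' 0 * b 0 = 0 := by linear_combination b' 0 * ha - hW
          rcases mul_eq_zero.1 this with h1 | h1
          · simp [h1, ha]
          · exact absurd h1 hb
        · field_simp
          ring
    · refine ⟨a' 0 / a 0, ?_, ?_⟩
      · field_simp
        ring
      · field_simp
        linear_combination hW
  obtain ⟨c, hc1, hc2⟩ := hc
  obtain ⟨h1, h2⟩ := (h.sub_smul h' c).eq_zero_of_initial hm 0 hc1 hc2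
  exact ⟨c, fun x => sub_eq_zero.1 (congrFun h1 x), fun x => sub_eq_zero.1 (congrFun h2 x)⟩

end IsChiralSolution

lemma integral_mul_star {a : ℝ → ℂ} : ∫ x, a x * star (a x) = ((∫ x, ‖a x‖ ^ 2 : ℝ) : ℂ) := by
  rw [← integral_complex_ofReal]
  congr 1
  funext x
  simpa using Complex.mul_conj' (a x)

lemma eq_zero_of_integral_mul_star {a : ℝ → ℂ} (hc : Continuous a) (ha : MemLp a 2 volume)
    (h : ∫ x, a x * star (a x) = 0) : a = 0 := by
  have h1 : ∫ x, ‖a x‖ ^ 2 = 0 := by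
    rw [integral_mul_star] at h
    exact_mod_cast h
  rw [integral_eq_zero_iff_of_nonneg (fun x => by positivity)
    ((memLp_two_iff_integrable_sq_norm ha.1).1 ha)] at h1
  have h2 := (Continuous.ae_eq_iff_eq volume (by fun_prop) (by fun_prop)).1 h1
  funext x
  simpa using congrFun h2 x

/-! ### The spectrum of the chiral system -/

/-- The chiral system with mass `m` and parameters `p`, `q` has a nonzero square-integrable
solution. -/
def HasChiralSolution (m : ℝ → ℝ) (p q : ℝ) : Prop :=
  ∃ a b, IsChiralSolution m p q a b ∧ (a ≠ 0 ∨ b ≠ 0)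

/-- The eigenvalues `E = ω² - k²` of the supersymmetric Schrödinger operator with superpotential `m`. -/
def chiralSpectrum (m : ℝ → ℝ) : Set ℝ := {E | HasChiralSolution m 1 E}

section

variable {m : ℝ → ℝ} {p q : ℝ} {a b : ℝ → ℂ}

/-- The solution is a(0) exp(∫m), with modulus at least |a(0)| because ∫m ≥ 0. This is where the
sign of the kink selects one chirality. -/
lemma IsChiralSolution.fst_eq_zero_of_decoupled (hm : IsKink m)
    (hd : ∀ x, HasDerivAt a (m x * a x) x) (ha : MemLp a 2 volume) : a = 0 := by
  set M : ℝ → ℝ := fun x => ∫ t in (0 : ℝ)..x, m t with hM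
  have hder : ∀ x, HasDerivAt (fun x => a x * ((Real.exp (-M x) : ℝ) : ℂ)) 0 x := fun x =>
    ((hd x).mul ((hasDerivAt_primitive hm.continuous x).neg.exp.ofReal_comp)).congr_deriv (by
      push_cast
      ring)
  have hconst : ∀ x, a x = a 0 * ((Real.exp (M x) : ℝ) : ℂ) := fun x => by
    have h := is_const_of_deriv_eq_zero (fun z => (hder z).differentiableAt)
      (fun z => (hder z).deriv) x 0
    have h0 : M 0 = 0 := by simp [hM]
    simp only [h0, neg_zero, Real.exp_zero, Complex.ofReal_one, mul_one] at h
    rw [← h, mul_assoc, ← Complex.ofReal_mul, ← Real.exp_add]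
    simp
  have hL : MemLp (fun _ : ℝ => a 0) 2 volume := by
    refine ha.mono aestronglyMeasurable_const (Eventually.of_forall fun x => ?_)
    rw [hconst x, norm_mul, Complex.norm_real, Real.norm_eq_abs, Real.abs_exp]
    exact le_mul_of_one_le_right (norm_nonneg _) (Real.one_le_exp (hm.integral_nonneg x))
  have h0 : a 0 = 0 := by
    rcases (memLp_const_iff (by norm_num) (by norm_num)).1 hL with h | h
    · exact h
    · simp at h
  funext x
  rw [hconst x, h0, zero_mul, Pi.zero_apply]

lemma isChiralSolution_exp (hm : IsKink m) (q : ℝ) (N : ℂ) :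
    IsChiralSolution m 0 q 0 (fun x => N * ((Real.exp (-∫ t in (0 : ℝ)..x, m t) : ℝ) : ℂ)) where
  deriv_fst x := (hasDerivAt_const x (0 : ℂ)).congr_deriv (by simp)
  deriv_snd x := (((hasDerivAt_primitive hm.continuous x).neg.exp.ofReal_comp).const_mul
    N).congr_deriv (by push_cast; simp; ring)
  memLp_fst := MemLp.zero
  memLp_snd := hm.memLp_exp.const_mul N

lemma hasChiralSolution_zero_left (hm : IsKink m) (q : ℝ) : HasChiralSolution m 0 q :=
  ⟨_, _, isChiralSolution_exp hm q 1, Or.inr fun h0 => by simpa using congrFun h0 0⟩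

lemma IsChiralSolution.fst_ne_zero (hp : p ≠ 0) (h : IsChiralSolution m p q a b)
    (h0 : a ≠ 0 ∨ b ≠ 0) : a ≠ 0 := by
  rintro rfl
  refine h0.elim (fun h => h rfl) fun h0 => h0 (funext fun x => ?_)
  have := (h.deriv_fst x).unique (hasDerivAt_const x (0 : ℂ))
  simpa [hp] using this

/-- Pairing the solution with its conjugate gives ∫|b|² = E ∫|a|². Neither side vanishes: b = 0
would leave a' = m a. -/
lemma pos_of_mem_chiralSpectrum (hm : IsKink m) {E : ℝ} (hE : E ∈ chiralSpectrum m) : 0 < E := by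
  obtain ⟨a, b, h, h0⟩ := hE
  have ha := h.fst_ne_zero one_ne_zero h0
  have key := h.mul_integral_eq h.conj
  rw [integral_mul_star, integral_mul_star] at key
  norm_cast at key
  rw [one_mul] at key
  have hApos : 0 ≤ ∫ x, ‖a x‖ ^ 2 := integral_nonneg fun x => by positivity
  have hBpos : 0 ≤ ∫ x, ‖b x‖ ^ 2 := integral_nonneg fun x => by positivity
  have hA : ∫ x, ‖a x‖ ^ 2 ≠ 0 := fun hA =>
    ha (eq_zero_of_integral_mul_star h.continuous_fst h.memLp_fst (by
      rw [integral_mul_star, hA, Complex.ofReal_zero]))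
  have hB : ∫ x, ‖b x‖ ^ 2 ≠ 0 := fun hB => by
    have hb := eq_zero_of_integral_mul_star h.continuous_snd h.memLp_snd (by
      rw [integral_mul_star, hB, Complex.ofReal_zero])
    refine ha (IsChiralSolution.fst_eq_zero_of_decoupled hm (fun x =>
      (h.deriv_fst x).congr_deriv ?_) h.memLp_fst)
    simp [hb]
  have hB' := lt_of_le_of_ne hBpos hB.symm
  rw [key] at hB'
  exact pos_of_mul_pos_left hB' hApos

lemma hasChiralSolution_iff (hm : IsKink m) :
    HasChiralSolution m p q ↔ p = 0 ∨ p * q ∈ chiralSpectrum m := by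
  constructor
  · rintro ⟨a, b, h, h0⟩
    refine or_iff_not_imp_left.2 fun hp => ⟨_, _, by simpa [hp] using h.scale hp,
      Or.inl (h.fst_ne_zero hp h0)⟩
  · rintro (rfl | ⟨a, b, h, h0⟩)
    · exact hasChiralSolution_zero_left hm q
    · have hE := pos_of_mem_chiralSpectrum hm ⟨a, b, h, h0⟩
      have hp : p ≠ 0 := left_ne_zero_of_mul hE.ne'
      -- Rescaling b by p⁻¹ carries the parameters (1, pq) back to (p, q).
      have hs := h.scale (inv_ne_zero hp)
      rw [one_div, inv_inv, inv_mul_cancel_left₀ hp] at hs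
      exact ⟨a, _, hs, Or.inl (h.fst_ne_zero one_ne_zero h0)⟩

end

/-- A family of pairwise orthogonal nonzero vectors in a separable inner product space is
countable. -/
lemma countable_of_pairwise_inner_eq_zero {E ι : Type*} [NormedAddCommGroup E]
    [InnerProductSpace ℂ E] [TopologicalSpace.SeparableSpace E] (v : ι → E) (h0 : ∀ i, v i ≠ 0)
    (h : ∀ i j, i ≠ j → inner ℂ (v i) (v j) = 0) : Countable ι := by
  set u : ι → E := fun i => ((‖v i‖⁻¹ : ℝ) : ℂ) • v i
  have hu : ∀ i, ‖u i‖ = 1 := fun i => by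
    simp only [u, norm_smul, Complex.norm_real, norm_inv, norm_norm]
    exact inv_mul_cancel₀ (norm_ne_zero_iff.2 (h0 i))
  -- Orthonormal vectors are √2 apart, so the balls of radius 1/2 around them are disjoint.
  have hdist : ∀ i j, i ≠ j → 1 ≤ dist (u i) (u j) := fun i j hij => by
    have hin : inner ℂ (u i) (u j) = 0 := by
      simp only [u, inner_smul_left, inner_smul_right, h i j hij, mul_zero]
    have h2 := norm_sub_sq (𝕜 := ℂ) (u i) (u j)
    rw [hin, hu, hu] at h2
    simp only [map_zero] at h2
    rw [dist_eq_norm]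
    nlinarith [norm_nonneg (u i - u j)]
  refine Pairwise.countable_of_isOpen_disjoint (s := fun i => Metric.ball (u i) (1 / 2))
    (fun i j hij => ?_) (fun _ => Metric.isOpen_ball) fun i => ⟨u i, by simp⟩
  exact Metric.ball_disjoint_ball (by linarith [hdist i j hij])

lemma countable_chiralSpectrum (m : ℝ → ℝ) : (chiralSpectrum m).Countable := by
  have hex : ∀ E : chiralSpectrum m, ∃ a b, IsChiralSolution m 1 E a b ∧ (a ≠ 0 ∨ b ≠ 0) :=
    fun E => E.2
  choose a b h h0 using hex
  have : Fact ((2 : ENNReal) ≠ ⊤) := ⟨by norm_num⟩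
  refine countable_of_pairwise_inner_eq_zero (fun E => (h E).memLp_fst.toLp (a E))
    (fun E hE => ?_) fun E F hEF => ?_
  · refine (h E).fst_ne_zero one_ne_zero (h0 E) ?_
    have hz : a E =ᵐ[volume] 0 := ((h E).memLp_fst.coeFn_toLp).symm.trans
      ((Lp.eq_zero_iff_ae_eq_zero).1 hE)
    exact (Continuous.ae_eq_iff_eq volume (h E).continuous_fst continuous_const).1 hz
  · have h1 := (h F).mul_integral_eq (h E).conj
    have h2 := (h E).conj.mul_integral_eq (h F)
    have hint : ∫ x, a F x * star (a E x) = 0 := by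
      have hc1 : ∫ x, star (a E x) * a F x = ∫ x, a F x * star (a E x) := by simp_rw [mul_comm]
      have hc2 : ∫ x, star (b E x) * b F x = ∫ x, b F x * star (b E x) := by simp_rw [mul_comm]
      rw [hc1, hc2] at h2
      have h3 : ((E : ℝ) - (F : ℝ) : ℂ) * ∫ x, a F x * star (a E x) = 0 := by
        linear_combination h2 - h1
      refine (mul_eq_zero.1 h3).resolve_left fun h4 => hEF (Subtype.ext ?_)
      exact_mod_cast sub_eq_zero.1 h4
    rw [L2.inner_def, ← hint]
    refine integral_congr_ae ?_
    filter_upwards [(h E).memLp_fst.coeFn_toLp, (h F).memLp_fst.coeFn_toLp] with x hx hy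
    rw [hx, hy]
    simp

/-! ### Bound states and the chiral system -/

lemma diracFiber_eq (m : ℝ → ℝ) (k : ℝ) (ψ : ℝ → Fin 2 → ℂ) (x : ℝ) :
    diracFiber m k ψ x = ![m x * ψ x 0 + k * ψ x 1 - deriv ψ x 1,
      k * ψ x 0 + deriv ψ x 0 - m x * ψ x 1] := by
  funext i
  fin_cases i
  · simp [diracFiber, pauli1, pauli2, pauli3, dotProduct, Fin.sum_univ_two]
    linear_combination deriv ψ x 1 * Complex.I_mul_I
  · simp [diracFiber, pauli1, pauli2, pauli3, dotProduct, Fin.sum_univ_two]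
    linear_combination -deriv ψ x 0 * Complex.I_mul_I

lemma IsBoundState.isChiralSolution {m : ℝ → ℝ} {k ω : ℝ} {ψ : ℝ → Fin 2 → ℂ}
    (h : IsBoundState m k ω ψ) : IsChiralSolution m (ω + k) (ω - k)
      (fun x => ψ x 0 + ψ x 1) (fun x => ψ x 0 - ψ x 1) := by
  have hd : ∀ i x, HasDerivAt (fun x => ψ x i) (deriv ψ x i) x := fun i x =>
    hasDerivAt_pi.1 (h.differentiable x).hasDerivAt i
  have he : ∀ x, m x * ψ x 0 + k * ψ x 1 - deriv ψ x 1 = ω * ψ x 0 ∧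
      k * ψ x 0 + deriv ψ x 0 - m x * ψ x 1 = ω * ψ x 1 := fun x => by
    have := h.eigen x
    rw [diracFiber_eq] at this
    exact ⟨by simpa using congrFun this 0, by simpa using congrFun this 1⟩
  refine ⟨fun x => ((hd 0 x).add (hd 1 x)).congr_deriv ?_,
    fun x => ((hd 0 x).sub (hd 1 x)).congr_deriv ?_, (h.memLp.eval 0).add (h.memLp.eval 1),
    (h.memLp.eval 0).sub (h.memLp.eval 1)⟩
  · push_cast
    linear_combination (he x).2 - (he x).1
  · push_cast
    linear_combination (he x).2 + (he x).1

lemma IsChiralSolution.isBoundState {m : ℝ → ℝ} {k ω : ℝ} {ψ : ℝ → Fin 2 → ℂ}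
    (h : IsChiralSolution m (ω + k) (ω - k) (fun x => ψ x 0 + ψ x 1) (fun x => ψ x 0 - ψ x 1))
    (h0 : ψ ≠ 0) : IsBoundState m k ω ψ := by
  have e0 : (fun x => ψ x 0) = fun x => (1 / 2 : ℂ) * ((ψ x 0 + ψ x 1) + (ψ x 0 - ψ x 1)) := by
    funext x; ring
  have e1 : (fun x => ψ x 1) = fun x => (1 / 2 : ℂ) * ((ψ x 0 + ψ x 1) - (ψ x 0 - ψ x 1)) := by
    funext x; ring
  have hd0 : ∀ x, HasDerivAt (fun x => ψ x 0) (ω * ψ x 1 - k * ψ x 0 + m x * ψ x 1) x := by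
    rw [e0]
    exact fun x => (((h.deriv_fst x).add (h.deriv_snd x)).const_mul _).congr_deriv (by
      push_cast
      ring)
  have hd1 : ∀ x, HasDerivAt (fun x => ψ x 1) (m x * ψ x 0 + k * ψ x 1 - ω * ψ x 0) x := by
    rw [e1]
    exact fun x => (((h.deriv_fst x).sub (h.deriv_snd x)).const_mul _).congr_deriv (by
      push_cast
      ring)
  have hd : ∀ x, HasDerivAt ψ ![ω * ψ x 1 - k * ψ x 0 + m x * ψ x 1,
      m x * ψ x 0 + k * ψ x 1 - ω * ψ x 0] x := fun x => by
    refine hasDerivAt_pi.2 fun i => ?_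
    fin_cases i
    · exact hd0 x
    · exact hd1 x
  refine ⟨fun x => (hd x).differentiableAt, MemLp.of_eval fun i => ?_, h0, fun x => ?_⟩
  · fin_cases i
    · change MemLp (fun x => ψ x 0) 2 volume
      rw [e0]
      exact (h.memLp_fst.add h.memLp_snd).const_mul _
    · change MemLp (fun x => ψ x 1) 2 volume
      rw [e1]
      exact (h.memLp_fst.sub h.memLp_snd).const_mul _
  · rw [diracFiber_eq, (hd x).deriv]
    funext i
    fin_cases i
    · simp
    · simp; ring

lemma chiral_ne_zero_iff {ψ : ℝ → Fin 2 → ℂ} :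
    ((fun x => ψ x 0 + ψ x 1) ≠ 0 ∨ (fun x => ψ x 0 - ψ x 1) ≠ 0) ↔ ψ ≠ 0 := by
  rw [← not_and_or, not_iff_not]
  constructor
  · rintro ⟨h1, h2⟩
    funext x i
    have h1 := congrFun h1 x
    have h2 := congrFun h2 x
    simp only [Pi.zero_apply] at h1 h2
    fin_cases i
    · simp only [Fin.zero_eta, Pi.zero_apply]
      linear_combination (h1 + h2) / 2
    · simp only [Fin.mk_one, Pi.zero_apply]
      linear_combination (h1 - h2) / 2
  · rintro rfl
    constructor <;> (funext x; simp)

lemma exists_isBoundState_iff {m : ℝ → ℝ} {k ω : ℝ} :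
    (∃ ψ, IsBoundState m k ω ψ) ↔ HasChiralSolution m (ω + k) (ω - k) := by
  constructor
  · rintro ⟨ψ, h⟩
    exact ⟨_, _, h.isChiralSolution, chiral_ne_zero_iff.2 h.ne_zero⟩
  · rintro ⟨a, b, h, h0⟩
    have ha : (fun x => (a x + b x) / 2 + (a x - b x) / 2) = a := by funext x; ring
    have hb : (fun x => (a x + b x) / 2 - (a x - b x) / 2) = b := by funext x; ring
    refine ⟨fun x => ![(a x + b x) / 2, (a x - b x) / 2], IsChiralSolution.isBoundState ?_
      (chiral_ne_zero_iff.1 ?_)⟩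
    · simpa [ha, hb] using h
    · simpa [ha, hb] using h0

/-- Bound-state energies are simple. -/
lemma IsBoundState.exists_eq_smul {m : ℝ → ℝ} {k ω : ℝ} {ψ φ : ℝ → Fin 2 → ℂ}
    (hm : ∃ C, 0 ≤ C ∧ ∀ x, |m x| ≤ C) (hψ : IsBoundState m k ω ψ) (hφ : IsBoundState m k ω φ) :
    ∃ a : ℂ, φ = a • ψ := by
  obtain ⟨c, h1, h2⟩ := hψ.isChiralSolution.exists_eq_smul hφ.isChiralSolution hm
    (chiral_ne_zero_iff.2 hψ.ne_zero)
  refine ⟨c, ?_⟩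
  funext x i
  have h1 := h1 x
  have h2 := h2 x
  fin_cases i
  · simp only [Fin.zero_eta, Pi.smul_apply, smul_eq_mul]
    linear_combination (h1 + h2) / 2
  · simp only [Fin.mk_one, Pi.smul_apply, smul_eq_mul]
    linear_combination (h1 - h2) / 2

/-- The bound-state energies of all fibers: one chiral branch `ω = s k` and the branches
`ω² = k² + E`, `E ∈ S`. -/
structure IsSpectralData (m : ℝ → ℝ) (s : ℝ) (S : Set ℝ) : Prop where
  sq_eq_one : s ^ 2 = 1
  countable : S.Countable
  pos : ∀ E ∈ S, 0 < E
  bound_iff : ∀ k ω, (∃ ψ, IsBoundState m k ω ψ) ↔ ω = s * k ∨ ω ^ 2 - k ^ 2 ∈ S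

lemma IsKink.isSpectralData {m : ℝ → ℝ} (hm : IsKink m) :
    IsSpectralData m (-1) (chiralSpectrum m) where
  sq_eq_one := by norm_num
  countable := countable_chiralSpectrum m
  pos _ := pos_of_mem_chiralSpectrum hm
  bound_iff k ω := by
    rw [exists_isBoundState_iff, hasChiralSolution_iff hm, neg_one_mul, eq_neg_iff_add_eq_zero,
      show ω ^ 2 - k ^ 2 = (ω + k) * (ω - k) by ring]

lemma hasChiralSolution_neg_iff {m : ℝ → ℝ} {p q : ℝ} :
    HasChiralSolution m p q ↔ HasChiralSolution (-m) q p := by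
  have key : ∀ {m : ℝ → ℝ} {p q : ℝ}, HasChiralSolution m p q → HasChiralSolution (-m) q p := by
    rintro m p q ⟨a, b, h, h0⟩
    exact ⟨_, _, h.swap, h0.symm.imp_right neg_ne_zero.2⟩
  exact ⟨key, fun h => by simpa using key h⟩

/-- For `-m` the roles of p and q are exchanged, so the exceptional branch is q = 0, that is ω = k.
-/
lemma IsKink.isSpectralData_of_neg {m : ℝ → ℝ} (hm : IsKink (-m)) :
    IsSpectralData m 1 (chiralSpectrum (-m)) where
  sq_eq_one := by norm_num
  countable := countable_chiralSpectrum _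
  pos _ := pos_of_mem_chiralSpectrum hm
  bound_iff k ω := by
    rw [exists_isBoundState_iff, hasChiralSolution_neg_iff, hasChiralSolution_iff hm, one_mul,
      sub_eq_zero, show ω ^ 2 - k ^ 2 = (ω - k) * (ω + k) by ring]

lemma psiL_apply (m : ℝ → ℝ) (x : ℝ) : psiL m x 0 =
    ((Real.exp (-∫ t in (0 : ℝ)..x, m t) : ℝ) : ℂ) ∧ psiL m x 1 =
    -((Real.exp (-∫ t in (0 : ℝ)..x, m t) : ℝ) : ℂ) := by
  simp [psiL]

lemma psiR_apply (m : ℝ → ℝ) (x : ℝ) : psiR m x 0 =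
    ((Real.exp (∫ t in (0 : ℝ)..x, m t) : ℝ) : ℂ) ∧ psiR m x 1 =
    ((Real.exp (∫ t in (0 : ℝ)..x, m t) : ℝ) : ℂ) := by
  simp [psiR]

lemma IsKink.isBoundState_psiL {m : ℝ → ℝ} (hm : IsKink m) {N : ℂ} (hN : N ≠ 0) (k : ℝ) :
    IsBoundState m k (-k) (N • psiL m) := by
  refine IsChiralSolution.isBoundState ?_ fun h0 => ?_
  · have h := isChiralSolution_exp hm (-k - k) (2 * N)
    convert h using 1
    · ring
    · funext x
      simp [psiL_apply]
    · funext x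
      simp only [Pi.smul_apply, smul_eq_mul, psiL_apply]
      ring
  · have := congrFun (congrFun h0 0) 0
    simp [psiL_apply, hN] at this

lemma IsKink.isBoundState_iff_psiL {m : ℝ → ℝ} (hm : IsKink m) (k : ℝ) (ψ : ℝ → Fin 2 → ℂ) :
    IsBoundState m k (-k) ψ ↔ ∃ N : ℂ, N ≠ 0 ∧ ψ = N • psiL m := by
  constructor
  · intro h
    obtain ⟨c, hc⟩ := (hm.isBoundState_psiL one_ne_zero k).exists_eq_smul hm.bounded h
    rw [one_smul] at hc
    exact ⟨c, fun h0 => h.ne_zero (by rw [hc, h0, zero_smul]), hc⟩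
  · rintro ⟨N, hN, rfl⟩
    exact hm.isBoundState_psiL hN k

lemma IsKink.isBoundState_psiR {m : ℝ → ℝ} (hm : IsKink (-m)) {N : ℂ} (hN : N ≠ 0) (k : ℝ) :
    IsBoundState m k k (N • psiR m) := by
  refine IsChiralSolution.isBoundState ?_ fun h0 => ?_
  · have h := (isChiralSolution_exp hm (k + k) (2 * N)).swap
    convert h using 1
    · simp
    · ring
    · funext x
      simp only [Pi.smul_apply, smul_eq_mul, psiR_apply, Pi.neg_apply,
        intervalIntegral.integral_neg, neg_neg]
      ring
    · funext x
      simp [psiR_apply]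
  · have := congrFun (congrFun h0 0) 0
    simp [psiR_apply, hN] at this

lemma IsKink.isBoundState_iff_psiR {m : ℝ → ℝ} (hm : IsKink (-m)) (k : ℝ) (ψ : ℝ → Fin 2 → ℂ) :
    IsBoundState m k k ψ ↔ ∃ N : ℂ, N ≠ 0 ∧ ψ = N • psiR m := by
  constructor
  · intro h
    obtain ⟨c, hc⟩ := (hm.isBoundState_psiR one_ne_zero k).exists_eq_smul
      (by simpa using hm.bounded) h
    rw [one_smul] at hc
    exact ⟨c, fun h0 => h.ne_zero (by rw [hc, h0, zero_smul]), hc⟩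
  · rintro ⟨N, hN, rfl⟩
    exact hm.isBoundState_psiR hN k

/-! ### Classification of the edge channels -/

/-- The branches of the spectrum described by `IsSpectralData`. -/
def IsSpectralCurve (s : ℝ) (S : Set ℝ) (f : ℝ → ℝ) : Prop :=
  (f = fun k => s * k) ∨
    ∃ E ∈ S, (f = fun k => Real.sqrt (k ^ 2 + E)) ∨ f = fun k => -Real.sqrt (k ^ 2 + E)

section

variable {m : ℝ → ℝ} {s : ℝ} {S : Set ℝ} {f g w : ℝ → ℝ} {D : Set ℝ}

lemma IsSpectralCurve.continuous (hf : IsSpectralCurve s S f) : Continuous f := by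
  rcases hf with rfl | ⟨E, -, rfl | rfl⟩ <;> fun_prop

namespace IsSpectralData

lemma isBranch (h : IsSpectralData m s S) (hf : IsSpectralCurve s S f) : IsBranch m univ f where
  isOpen := isOpen_univ
  nonempty := univ_nonempty
  ordConnected := ordConnected_univ
  continuousOn := hf.continuous.continuousOn
  bound k _ := by
    rw [h.bound_iff]
    rcases hf with rfl | ⟨E, hE, rfl | rfl⟩
    · exact Or.inl rfl
    · right
      rw [Real.sq_sqrt (by have := h.pos E hE; positivity)]
      simpa using hE
    · right
      rw [neg_sq, Real.sq_sqrt (by have := h.pos E hE; positivity)]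
      simpa using hE

lemma exists_curve_through (h : IsSpectralData m s S) {k ω : ℝ}
    (hb : ∃ ψ, IsBoundState m k ω ψ) : ∃ f, IsSpectralCurve s S f ∧ f k = ω := by
  rcases (h.bound_iff k ω).1 hb with rfl | hE
  · exact ⟨_, Or.inl rfl, rfl⟩
  · rcases le_total 0 ω with hω | hω
    · refine ⟨_, Or.inr ⟨_, hE, Or.inl rfl⟩, ?_⟩
      simp [Real.sqrt_sq hω]
    · refine ⟨_, Or.inr ⟨_, hE, Or.inr rfl⟩, ?_⟩
      simp [Real.sqrt_sq_eq_abs, abs_of_nonpos hω]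

/-- A point (k, ω) fixes ω² - k², which is 0 on the line and E > 0 on the hyperbolas, and the sign
of ω then fixes the half. -/
lemma curve_unique (h : IsSpectralData m s S) (hf : IsSpectralCurve s S f)
    (hg : IsSpectralCurve s S g) {k : ℝ} (hk : f k = g k) : f = g := by
  have hs := h.sq_eq_one
  have hsq : ∀ E ∈ S, Real.sqrt (k ^ 2 + E) ^ 2 = k ^ 2 + E := fun E hE =>
    Real.sq_sqrt (by have := h.pos E hE; positivity)
  have hpos : ∀ E ∈ S, 0 < Real.sqrt (k ^ 2 + E) := fun E hE =>
    Real.sqrt_pos.2 (by have := h.pos E hE; positivity)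
  have hsk : (s * k) ^ 2 = k ^ 2 := by rw [mul_pow, hs, one_mul]
  have hne : ∀ E ∈ S, (s * k) ^ 2 ≠ k ^ 2 + E := fun E hE => by
    rw [hsk]
    have := h.pos E hE
    linarith
  rcases hf with rfl | ⟨E, hE, rfl | rfl⟩ <;> rcases hg with rfl | ⟨F, hF, rfl | rfl⟩ <;>
    simp only at hk
  · rfl
  · exact absurd (by rw [hk, hsq F hF]) (hne F hF)
  · exact absurd (by rw [hk, neg_sq, hsq F hF]) (hne F hF)
  · exact absurd (by rw [← hk, hsq E hE]) (hne E hE)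
  · have := hsq E hE
    rw [hk, hsq F hF] at this
    rw [add_left_cancel this]
  · linarith [hpos E hE, hpos F hF]
  · exact absurd (by rw [← hk, neg_sq, hsq E hE]) (hne E hE)
  · linarith [hpos E hE, hpos F hF]
  · have := hsq E hE
    rw [neg_injective hk, hsq F hF] at this
    rw [add_left_cancel this]

lemma exists_curve_eqOn (h : IsSpectralData m s S) (hw : IsBranch m D w) :
    ∃ f, IsSpectralCurve s S f ∧ EqOn w f D := by
  have hconn : IsPreconnected D := hw.ordConnected.isPreconnected
  have hmem : ∀ k ∈ D, w k = s * k ∨ w k ^ 2 - k ^ 2 ∈ S := fun k hk =>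
    (h.bound_iff k (w k)).1 (hw.bound k hk)
  have hcont : ContinuousOn (fun k => w k ^ 2 - k ^ 2) D :=
    (hw.continuousOn.pow 2).sub (by fun_prop)
  have hsub : (fun k => w k ^ 2 - k ^ 2) '' D ⊆ insert 0 S := by
    rintro _ ⟨k, hk, rfl⟩
    rcases hmem k hk with h1 | h1
    · left
      simp only [h1, mul_pow, h.sq_eq_one]
      ring
    · exact Or.inr h1
  -- A connected subset of a countable set of reals is a point, so ω² - k² is constant along the
  -- branch.
  have hss := (h.countable.insert 0).isTotallyDisconnected _ hsub (hconn.image _ hcont)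
  obtain ⟨k₀, hk₀⟩ := hw.nonempty
  have hE : ∀ k ∈ D, w k ^ 2 - k ^ 2 = w k₀ ^ 2 - k₀ ^ 2 := fun k hk =>
    hss ⟨k, hk, rfl⟩ ⟨k₀, hk₀, rfl⟩
  generalize w k₀ ^ 2 - k₀ ^ 2 = E at hE
  by_cases hES : E ∈ S
  · have hpos := h.pos E hES
    have hc : ContinuousOn (fun k => Real.sqrt (k ^ 2 + E)) D := by fun_prop
    have hsq : EqOn (w ^ 2) ((fun k => Real.sqrt (k ^ 2 + E)) ^ 2) D := fun k hk => by
      simp only [Pi.pow_apply]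
      rw [Real.sq_sqrt (by positivity), ← hE k hk]
      ring
    -- The root never vanishes, so the sign cannot change on the connected set `D`.
    rcases hconn.eq_or_eq_neg_of_sq_eq hw.continuousOn hc hsq
      (fun {k} _ => (Real.sqrt_pos.2 (by positivity)).ne') with h1 | h1
    · exact ⟨_, Or.inr ⟨E, hES, Or.inl rfl⟩, h1⟩
    · exact ⟨_, Or.inr ⟨E, hES, Or.inr rfl⟩, h1⟩
  · refine ⟨_, Or.inl rfl, fun k hk => (hmem k hk).resolve_right ?_⟩
    rwa [hE k hk]

/-- Every branch of the spectrum is an edge channel. -/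
def channel (h : IsSpectralData m s S) (hf : IsSpectralCurve s S f) : EdgeChannel m where
  dom := univ
  energy := f
  isBranch := h.isBranch hf
  maximal _ _ _ hD _ := univ_subset_iff.1 hD
  energy_off k hk := absurd (mem_univ k) hk

/-- Every edge channel is a branch of the spectrum. -/
lemma channel_spec (h : IsSpectralData m s S) (c : EdgeChannel m) :
    c.dom = univ ∧ IsSpectralCurve s S c.energy := by
  obtain ⟨f, hf, hfe⟩ := h.exists_curve_eqOn c.isBranch
  -- The spectral curve extends the channel to all of ℝ, so maximality forces the full domain.
  have hdom : c.dom = univ := (c.maximal univ f (h.isBranch hf) (subset_univ _) hfe).symm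
  rw [hdom] at hfe
  exact ⟨hdom, (funext fun k => hfe (mem_univ k) : c.energy = f) ▸ hf⟩

lemma existsUnique_channel (h : IsSpectralData m s S) {k ω : ℝ}
    (hb : ∃ ψ, IsBoundState m k ω ψ) : ∃! c : EdgeChannel m, k ∈ c.dom ∧ c.energy k = ω := by
  obtain ⟨f, hf, hfk⟩ := h.exists_curve_through hb
  refine ⟨h.channel hf, ⟨mem_univ k, hfk⟩, fun c hc => ?_⟩
  obtain ⟨hdom, hcurve⟩ := h.channel_spec c
  exact EdgeChannel.ext hdom (h.curve_unique hcurve hf (hc.2.trans hfk.symm))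

end IsSpectralData

end

/-! ### Intersections with the Fermi line -/

/-- Reflection exchanges the one-sided neighbourhoods, turning upward crossings into downward ones.
-/
lemma localIntersection_neg {μ w : ℝ → ℝ} (hμ : ∀ k, μ (-k) = μ k) (hw : ∀ k, w (-k) = w k)
    (k : ℝ) : localIntersection μ w (-k) = -localIntersection μ w k := by
  have ht1 : Tendsto Neg.neg (𝓝[<] (-k)) (𝓝[>] k) := by simpa using tendsto_neg_nhdsLT (a := -k)
  have ht2 : Tendsto Neg.neg (𝓝[>] (-k)) (𝓝[<] k) := by simpa using tendsto_neg_nhdsGT (a := -k)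
  have ht3 : Tendsto Neg.neg (𝓝[<] k) (𝓝[>] (-k)) := tendsto_neg_nhdsLT
  have ht4 : Tendsto Neg.neg (𝓝[>] k) (𝓝[<] (-k)) := tendsto_neg_nhdsGT
  have hl : ∀ {u v : ℝ → ℝ}, (∀ k, u (-k) = u k) → (∀ k, v (-k) = v k) →
      ((∀ᶠ x in 𝓝[<] (-k), u x < v x) ↔ ∀ᶠ x in 𝓝[>] k, u x < v x) := fun {u v} hu hv =>
    ⟨fun h => by simpa [hu, hv] using ht4.eventually h,
      fun h => by simpa [hu, hv] using ht1.eventually h⟩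
  have hr : ∀ {u v : ℝ → ℝ}, (∀ k, u (-k) = u k) → (∀ k, v (-k) = v k) →
      ((∀ᶠ x in 𝓝[>] (-k), u x < v x) ↔ ∀ᶠ x in 𝓝[<] k, u x < v x) := fun {u v} hu hv =>
    ⟨fun h => by simpa [hu, hv] using ht3.eventually h,
      fun h => by simpa [hu, hv] using ht2.eventually h⟩
  -- The up and down conditions exclude each other, so the order of the two tests is immaterial.
  have hexcl : ¬((∀ᶠ x in 𝓝[<] k, w x < μ x) ∧ ∀ᶠ x in 𝓝[<] k, μ x < w x) := fun ⟨h1, h2⟩ => by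
    obtain ⟨x, hx1, hx2⟩ := (h1.and h2).exists
    exact lt_asymm hx1 hx2
  unfold localIntersection
  rw [hl hw hμ, hr hμ hw, hl hμ hw, hr hw hμ]
  split_ifs with h1 h2 h3 h4 <;> first | rfl | (exfalso; tauto)

lemma fermiLine_neg (mMinus mPlus ε k : ℝ) :
    fermiLine mMinus mPlus ε (-k) = fermiLine mMinus mPlus ε k := by
  simp [fermiLine]

/-- A channel with even energy has intersection number zero with an even line. -/
lemma intersectionNumber_eq_zero_of_even {m μ : ℝ → ℝ} {c : EdgeChannel m} (hdom : c.dom = univ)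
    (hμ : ∀ k, μ (-k) = μ k) (hc : ∀ k, c.energy (-k) = c.energy k) :
    intersectionNumber μ c = 0 := by
  have hmem : ∀ k, -k ∈ c.meeting μ ↔ k ∈ c.meeting μ := fun k => by
    simp [EdgeChannel.meeting, hdom, hμ, hc]
  have key : intersectionNumber μ c = -intersectionNumber μ c := by
    unfold intersectionNumber
    conv_lhs => rw [← finsum_comp_equiv (Equiv.neg ℝ)]
    rw [← finsum_neg_distrib]
    refine finsum_congr fun k => ?_
    rw [← finsum_neg_distrib]
    simp only [Equiv.neg_apply, localIntersection_neg hμ hc]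
    exact finsum_congr_Prop (propext (hmem k)) fun _ => rfl
  omega

lemma IsSpectralData.finite_meeting {m : ℝ → ℝ} {s : ℝ} {S : Set ℝ} (h : IsSpectralData m s S)
    (mMinus mPlus : ℝ) {ε : ℝ} (hε : 0 < ε) (c : EdgeChannel m) :
    (c.meeting (fermiLine mMinus mPlus ε)).Finite := by
  obtain ⟨E, hE⟩ : ∃ E, ∀ k, c.energy k ^ 2 = k ^ 2 + E := by
    rcases (h.channel_spec c).2 with hc | ⟨E, hES, hc | hc⟩
    · exact ⟨0, fun k => by rw [hc, mul_pow, h.sq_eq_one]; ring⟩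
    · exact ⟨E, fun k => by rw [hc, Real.sq_sqrt (by have := h.pos E hES; positivity)]⟩
    · exact ⟨E, fun k => by rw [hc, neg_sq, Real.sq_sqrt (by have := h.pos E hES; positivity)]⟩
  set M := massGap mMinus mPlus
  set A := ((ε ^ 2 + M ^ 2 - E) / (2 * ε)) ^ 2 - M ^ 2
  refine Set.Finite.subset (Set.toFinite {Real.sqrt A, -Real.sqrt A}) fun k hk => ?_
  have h1 : c.energy k = -ε + Real.sqrt (k ^ 2 + M ^ 2) := hk.2
  have h2 : Real.sqrt (k ^ 2 + M ^ 2) ^ 2 = k ^ 2 + M ^ 2 := Real.sq_sqrt (by positivity)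
  -- Inserting the Fermi line into ω² = k² + E cancels k² and leaves an equation linear in the root.
  have h3 : Real.sqrt (k ^ 2 + M ^ 2) = (ε ^ 2 + M ^ 2 - E) / (2 * ε) := by
    have := hE k
    rw [h1] at this
    rw [eq_div_iff (by positivity)]
    nlinarith
  have h4 : k ^ 2 = A := by
    rw [h3] at h2
    simp only [A]
    linarith
  rw [← h4, Real.sqrt_sq_eq_abs]
  rcases abs_choice k with h | h <;> simp [h]

lemma intersectionNumber_eq_of_unique {m μ : ℝ → ℝ} {c : EdgeChannel m} {k₀ : ℝ} {n : ℤ}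
    (hmeet : c.meeting μ = {k₀}) (hn : localIntersection μ c.energy k₀ = n) :
    intersectionNumber μ c = n := by
  rw [intersectionNumber, hmeet, finsum_mem_singleton, hn]

lemma intersectionNumber_of_energy_eq_id {m : ℝ → ℝ} {c : EdgeChannel m} (mMinus mPlus : ℝ)
    {ε : ℝ} (hε : 0 < ε) (hdom : c.dom = univ) (hc : ∀ k, c.energy k = k) :
    intersectionNumber (fermiLine mMinus mPlus ε) c = 1 := by
  set M := massGap mMinus mPlus with hM
  -- Squaring k + ε = √(k² + M²) leaves the linear equation 2εk = M² - ε².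
  set k₀ := (M ^ 2 - ε ^ 2) / (2 * ε) with hk₀
  have hk : 2 * ε * k₀ = M ^ 2 - ε ^ 2 := by rw [hk₀]; field_simp
  have hlt : ∀ k, k < k₀ → k < fermiLine mMinus mPlus ε k := fun k h => by
    have : k + ε < Real.sqrt (k ^ 2 + M ^ 2) := Real.lt_sqrt_of_sq_lt (by nlinarith)
    rw [fermiLine, ← hM]
    linarith
  -- Here 2ε(k + ε) ≥ M² + ε², so squaring is an equivalence from `k₀` on.
  have hge : ∀ k, k₀ ≤ k → 0 < k + ε := fun k h => by
    have : 0 < 2 * ε * (k + ε) := by nlinarith [sq_nonneg M]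
    exact pos_of_mul_pos_right this (by positivity)
  have hgt : ∀ k, k₀ < k → fermiLine mMinus mPlus ε k < k := fun k h => by
    have : Real.sqrt (k ^ 2 + M ^ 2) < k + ε := by
      rw [Real.sqrt_lt' (hge k h.le)]
      nlinarith
    rw [fermiLine, ← hM]
    linarith
  have heq : fermiLine mMinus mPlus ε k₀ = k₀ := by
    have : k₀ ^ 2 + M ^ 2 = (k₀ + ε) ^ 2 := by linear_combination -hk
    rw [fermiLine, ← hM, this, Real.sqrt_sq (hge k₀ le_rfl).le]
    ring
  refine intersectionNumber_eq_of_unique (k₀ := k₀) ?_ ?_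
  · ext k
    simp only [EdgeChannel.meeting, hdom, hc, mem_univ, true_and, mem_ofPred_eq,
      mem_singleton_iff]
    constructor
    · intro hkk
      rcases lt_trichotomy k k₀ with h | h | h
      · exact absurd hkk (hlt k h).ne
      · exact h
      · exact absurd hkk (hgt k h).ne'
    · rintro rfl
      exact heq.symm
  · rw [show c.energy = fun k => k from funext hc]
    exact if_pos ⟨eventually_nhdsWithin_of_forall hlt, eventually_nhdsWithin_of_forall hgt⟩

lemma intersectionNumber_of_energy_eq_neg {m : ℝ → ℝ} {c : EdgeChannel m} (mMinus mPlus : ℝ)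
    {ε : ℝ} (hε : 0 < ε) (hdom : c.dom = univ) (hc : ∀ k, c.energy k = -k) :
    intersectionNumber (fermiLine mMinus mPlus ε) c = -1 := by
  set M := massGap mMinus mPlus with hM
  set k₀ := (ε ^ 2 - M ^ 2) / (2 * ε) with hk₀
  have hk : 2 * ε * k₀ = ε ^ 2 - M ^ 2 := by rw [hk₀]; field_simp
  have hgt : ∀ k, k₀ < k → -k < fermiLine mMinus mPlus ε k := fun k h => by
    have : -k + ε < Real.sqrt (k ^ 2 + M ^ 2) := Real.lt_sqrt_of_sq_lt (by nlinarith)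
    rw [fermiLine, ← hM]
    linarith
  have hge : ∀ k, k ≤ k₀ → 0 < -k + ε := fun k h => by
    have : 0 < 2 * ε * (-k + ε) := by nlinarith [sq_nonneg M]
    exact pos_of_mul_pos_right this (by positivity)
  have hlt : ∀ k, k < k₀ → fermiLine mMinus mPlus ε k < -k := fun k h => by
    have : Real.sqrt (k ^ 2 + M ^ 2) < -k + ε := by
      rw [Real.sqrt_lt' (hge k h.le)]
      nlinarith
    rw [fermiLine, ← hM]
    linarith
  have heq : fermiLine mMinus mPlus ε k₀ = -k₀ := by
    have : k₀ ^ 2 + M ^ 2 = (-k₀ + ε) ^ 2 := by linear_combination hk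
    rw [fermiLine, ← hM, this, Real.sqrt_sq (hge k₀ le_rfl).le]
    ring
  refine intersectionNumber_eq_of_unique (k₀ := k₀) ?_ ?_
  · ext k
    simp only [EdgeChannel.meeting, hdom, hc, mem_univ, true_and, mem_ofPred_eq,
      mem_singleton_iff]
    constructor
    · intro hkk
      rcases lt_trichotomy k k₀ with h | h | h
      · exact absurd hkk (hlt k h).ne'
      · exact h
      · exact absurd hkk (hgt k h).ne
    · rintro rfl
      exact heq.symm
  · rw [show c.energy = fun k => -k from funext hc, localIntersection]
    rw [if_neg, if_pos ⟨eventually_nhdsWithin_of_forall hlt, eventually_nhdsWithin_of_forall hgt⟩]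
    rintro ⟨h1, -⟩
    obtain ⟨x, hx1, hx2⟩ :=
      (h1.and (eventually_nhdsWithin_of_forall (s := Iio k₀) hlt)).exists
    exact lt_asymm hx1 hx2

namespace IsSpectralData

variable {m : ℝ → ℝ} {s : ℝ} {S : Set ℝ}

/-- The chiral edge channel `ω(k) = s k`. -/
def chiralChannel (h : IsSpectralData m s S) : EdgeChannel m := h.channel (Or.inl rfl)

lemma intersectionNumber_eq_zero (h : IsSpectralData m s S) (mMinus mPlus ε : ℝ)
    {c : EdgeChannel m} (hc : c ≠ h.chiralChannel) :
    intersectionNumber (fermiLine mMinus mPlus ε) c = 0 := by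
  obtain ⟨hdom, hcurve⟩ := h.channel_spec c
  refine intersectionNumber_eq_zero_of_even hdom (fermiLine_neg _ _ _) fun k => ?_
  rcases hcurve with hc' | ⟨E, -, hc' | hc'⟩
  · exact absurd (EdgeChannel.ext hdom hc') hc
  · simp [hc']
  · simp [hc']

lemma edgeIndex_eq (h : IsSpectralData m s S) (mMinus mPlus ε : ℝ) :
    edgeIndex m mMinus mPlus ε =
      -intersectionNumber (fermiLine mMinus mPlus ε) h.chiralChannel := by
  rw [edgeIndex, finsum_eq_single _ h.chiralChannel fun c hc =>
    h.intersectionNumber_eq_zero mMinus mPlus ε hc]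

end IsSpectralData

/-! ### The bulk index -/

/-- The projection onto the positive band of `(k₁, k₂, μ) · σ`. -/
def bandProjection (μ : ℝ) (k : ℝ × ℝ) : Matrix (Fin 2) (Fin 2) ℂ :=
  !![1 / 2 + μ * ((Real.sqrt (k.1 ^ 2 + k.2 ^ 2 + μ ^ 2))⁻¹ : ℝ) / 2,
    (k.1 - Complex.I * k.2) * ((Real.sqrt (k.1 ^ 2 + k.2 ^ 2 + μ ^ 2))⁻¹ : ℝ) / 2;
    (k.1 + Complex.I * k.2) * ((Real.sqrt (k.1 ^ 2 + k.2 ^ 2 + μ ^ 2))⁻¹ : ℝ) / 2,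
    1 / 2 - μ * ((Real.sqrt (k.1 ^ 2 + k.2 ^ 2 + μ ^ 2))⁻¹ : ℝ) / 2]

/-- Normalizing the vector removes the positive factor introduced by the hemisphere chart. -/
lemma half_one_add_dotPauli {μ : ℝ} {k : ℝ × ℝ} {c : ℝ} (hc : 0 < c) :
    (1 / 2 : ℂ) • (1 + dotPauli ((Real.sqrt (∑ i, (c • ![k.1, k.2, μ]) i ^ 2))⁻¹ •
      (c • ![k.1, k.2, μ]))) = bandProjection μ k := by
  have hsum : Real.sqrt (∑ i, (c • ![k.1, k.2, μ]) i ^ 2)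
      = c * Real.sqrt (k.1 ^ 2 + k.2 ^ 2 + μ ^ 2) := by
    rw [← Real.sqrt_sq hc.le, ← Real.sqrt_mul (sq_nonneg c), Real.sqrt_sq hc.le]
    congr 1
    simp [Fin.sum_univ_three]
    ring
  rw [hsum, smul_smul, mul_inv_rev, inv_mul_cancel_right₀ hc.ne']
  ext i j
  fin_cases i <;> fin_cases j <;>
    simp [dotPauli, pauli1, pauli2, pauli3, bandProjection] <;> ring

lemma blochProjection_chart_one (mMinus mPlus : ℝ) (k : ℝ × ℝ) :
    blochProjection mMinus mPlus (hemisphereChart 1 k) = bandProjection mPlus k := by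
  have hpos : 0 < (Real.sqrt (1 + k.1 ^ 2 + k.2 ^ 2))⁻¹ := by positivity
  have h : bulkVector mMinus mPlus (hemisphereChart 1 k)
      = (Real.sqrt (1 + k.1 ^ 2 + k.2 ^ 2))⁻¹ • ![k.1, k.2, mPlus] := by
    funext i
    fin_cases i
    · simp [bulkVector, hemisphereChart, hemispherePoint]
    · simp [bulkVector, hemisphereChart, hemispherePoint]
    · simp [bulkVector, hemisphereChart, hemispherePoint, mul_comm]
  rw [blochProjection, h, half_one_add_dotPauli hpos]

lemma blochProjection_chart_neg_one (mMinus mPlus : ℝ) (k : ℝ × ℝ) :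
    blochProjection mMinus mPlus (hemisphereChart (-1) k) = bandProjection mMinus k := by
  have hpos : 0 < (Real.sqrt (1 + k.1 ^ 2 + k.2 ^ 2))⁻¹ := by positivity
  have h : bulkVector mMinus mPlus (hemisphereChart (-1) k)
      = (Real.sqrt (1 + k.1 ^ 2 + k.2 ^ 2))⁻¹ • ![k.1, k.2, mMinus] := by
    funext i
    fin_cases i
    · simp [bulkVector, hemisphereChart, hemispherePoint]
    · simp [bulkVector, hemisphereChart, hemispherePoint]
    · simp [bulkVector, hemisphereChart, hemispherePoint, mul_comm]
  rw [blochProjection, h, half_one_add_dotPauli hpos]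

lemma hasDerivAt_inv_sqrt {c : ℝ} (hc : 0 < c) (t : ℝ) :
    HasDerivAt (fun t : ℝ => (Real.sqrt (t ^ 2 + c))⁻¹) (-t * (Real.sqrt (t ^ 2 + c))⁻¹ ^ 3) t := by
  have hpos : 0 < t ^ 2 + c := by positivity
  have hs : 0 < Real.sqrt (t ^ 2 + c) := Real.sqrt_pos.2 hpos
  refine ((((hasDerivAt_id t).pow 2).add_const c).sqrt hpos.ne').inv hs.ne' |>.congr_deriv ?_
  simp only [id, Pi.pow_apply]
  field_simp
  norm_num

set_option linter.unusedSimpArgs false in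
-- With d = (k₁, k₂, μ) and e = d/|d|, the trace is (i/2) e · (∂₁e × ∂₂e), and the triple product is
-- μ/|d|³.
lemma curvature_bandProjection {μ : ℝ} (hμ : μ ≠ 0) (k : ℝ × ℝ) :
    curvature (bandProjection μ) k
      = Complex.I / 2 * ((μ * (Real.sqrt (k.1 ^ 2 + k.2 ^ 2 + μ ^ 2))⁻¹ ^ 3 : ℝ) : ℂ) := by
  obtain ⟨k₁, k₂⟩ := k
  set ρ : ℝ := (Real.sqrt (k₁ ^ 2 + k₂ ^ 2 + μ ^ 2))⁻¹ with hρ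
  have h1 : HasDerivAt (fun t : ℝ => (((Real.sqrt (t ^ 2 + k₂ ^ 2 + μ ^ 2))⁻¹ : ℝ) : ℂ))
      ((-k₁ * ρ ^ 3 : ℝ) : ℂ) k₁ := by
    have := (hasDerivAt_inv_sqrt (c := k₂ ^ 2 + μ ^ 2) (by positivity) k₁).ofReal_comp
    simpa only [← add_assoc] using this
  have h2 : HasDerivAt (fun t : ℝ => (((Real.sqrt (k₁ ^ 2 + t ^ 2 + μ ^ 2))⁻¹ : ℝ) : ℂ))
      ((-k₂ * ρ ^ 3 : ℝ) : ℂ) k₂ := by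
    have := (hasDerivAt_inv_sqrt (c := k₁ ^ 2 + μ ^ 2) (by positivity) k₂).ofReal_comp
    have e : ∀ t : ℝ, t ^ 2 + (k₁ ^ 2 + μ ^ 2) = k₁ ^ 2 + t ^ 2 + μ ^ 2 := fun t => by ring
    simpa only [e] using this
  have hid : ∀ t : ℝ, HasDerivAt (fun t : ℝ => (t : ℂ)) 1 t := fun t =>
    (hasDerivAt_id t).ofReal_comp
  have d1 : (Matrix.of fun i j => deriv (fun t => bandProjection μ (t, k₂) i j) k₁) =
      !![(μ : ℂ) * (-k₁ * ρ ^ 3) / 2, (ρ + (k₁ - Complex.I * k₂) * (-k₁ * ρ ^ 3)) / 2;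
        (ρ + (k₁ + Complex.I * k₂) * (-k₁ * ρ ^ 3)) / 2, -((μ : ℂ) * (-k₁ * ρ ^ 3) / 2)] := by
    ext i j
    fin_cases i <;> fin_cases j
    · refine HasDerivAt.deriv ((((h1.const_mul (μ : ℂ)).div_const 2).const_add (1 / 2)).congr_deriv
        ?_)
      simp only [Fin.zero_eta, Fin.mk_one, Fin.isValue, Matrix.of_apply, Matrix.cons_val', Matrix.cons_val_zero,
        Matrix.cons_val_one, Matrix.cons_val_fin_one, ← hρ]
      push_cast
      ring
    · refine HasDerivAt.deriv (((((hid k₁).sub_const (Complex.I * k₂)).mul h1).div_const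
        2).congr_deriv ?_)
      simp only [Fin.zero_eta, Fin.mk_one, Fin.isValue, Matrix.of_apply, Matrix.cons_val', Matrix.cons_val_zero,
        Matrix.cons_val_one, Matrix.cons_val_fin_one, ← hρ]
      push_cast
      ring
    · refine HasDerivAt.deriv (((((hid k₁).add_const (Complex.I * k₂)).mul h1).div_const
        2).congr_deriv ?_)
      simp only [Fin.zero_eta, Fin.mk_one, Fin.isValue, Matrix.of_apply, Matrix.cons_val', Matrix.cons_val_zero,
        Matrix.cons_val_one, Matrix.cons_val_fin_one, ← hρ]
      push_cast
      ring
    · refine HasDerivAt.deriv ((((h1.const_mul (μ : ℂ)).div_const 2).const_sub (1 / 2)).congr_deriv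
        ?_)
      simp only [Fin.zero_eta, Fin.mk_one, Fin.isValue, Matrix.of_apply, Matrix.cons_val', Matrix.cons_val_zero,
        Matrix.cons_val_one, Matrix.cons_val_fin_one, ← hρ]
      push_cast
      ring
  have d2 : (Matrix.of fun i j => deriv (fun t => bandProjection μ (k₁, t) i j) k₂) =
      !![(μ : ℂ) * (-k₂ * ρ ^ 3) / 2, (-Complex.I * ρ + (k₁ - Complex.I * k₂) * (-k₂ * ρ ^ 3)) / 2;
        (Complex.I * ρ + (k₁ + Complex.I * k₂) * (-k₂ * ρ ^ 3)) / 2,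
        -((μ : ℂ) * (-k₂ * ρ ^ 3) / 2)] := by
    ext i j
    fin_cases i <;> fin_cases j
    · refine HasDerivAt.deriv ((((h2.const_mul (μ : ℂ)).div_const 2).const_add (1 / 2)).congr_deriv
        ?_)
      simp only [Fin.zero_eta, Fin.mk_one, Fin.isValue, Matrix.of_apply, Matrix.cons_val', Matrix.cons_val_zero,
        Matrix.cons_val_one, Matrix.cons_val_fin_one, ← hρ]
      push_cast
      ring
    · refine HasDerivAt.deriv ((((((hid k₂).const_mul Complex.I).const_sub (k₁ : ℂ)).mul
        h2).div_const 2).congr_deriv ?_)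
      simp only [Fin.zero_eta, Fin.mk_one, Fin.isValue, Matrix.of_apply, Matrix.cons_val', Matrix.cons_val_zero,
        Matrix.cons_val_one, Matrix.cons_val_fin_one, ← hρ]
      push_cast
      ring
    · refine HasDerivAt.deriv ((((((hid k₂).const_mul Complex.I).const_add (k₁ : ℂ)).mul
        h2).div_const 2).congr_deriv ?_)
      simp only [Fin.zero_eta, Fin.mk_one, Fin.isValue, Matrix.of_apply, Matrix.cons_val', Matrix.cons_val_zero,
        Matrix.cons_val_one, Matrix.cons_val_fin_one, ← hρ]
      push_cast
      ring
    · refine HasDerivAt.deriv ((((h2.const_mul (μ : ℂ)).div_const 2).const_sub (1 / 2)).congr_deriv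
        ?_)
      simp only [Fin.zero_eta, Fin.mk_one, Fin.isValue, Matrix.of_apply, Matrix.cons_val', Matrix.cons_val_zero,
        Matrix.cons_val_one, Matrix.cons_val_fin_one, ← hρ]
      push_cast
      ring
  simp only [curvature]
  rw [d1, d2]
  simp only [bandProjection, ← hρ, Matrix.trace_fin_two, Matrix.mul_apply,
    Matrix.sub_apply, Fin.sum_univ_two, Matrix.of_apply, Matrix.cons_val', Matrix.cons_val_zero,
    Matrix.cons_val_one, Matrix.cons_val_fin_one]
  -- Derivatives of ρ contribute only multiples of d, which drop out of the triple product; the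
  -- identity is thus polynomial and needs no relation between ρ and d.
  push_cast
  ring

lemma integral_radial {μ : ℝ} (hμ : μ ≠ 0) :
    ∫ r in Ioi (0 : ℝ), r * (Real.sqrt (r ^ 2 + μ ^ 2))⁻¹ ^ 3 = |μ|⁻¹ := by
  have hlim : Tendsto (fun r : ℝ => -(Real.sqrt (r ^ 2 + μ ^ 2))⁻¹) atTop (𝓝 (-0)) := by
    refine (tendsto_inv_atTop_zero.comp (Real.tendsto_sqrt_atTop.comp ?_)).neg
    exact tendsto_atTop_add_const_right _ _ (tendsto_pow_atTop two_ne_zero)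
  have h := integral_Ioi_of_hasDerivAt_of_nonneg' (a := 0)
    (g := fun r : ℝ => -(Real.sqrt (r ^ 2 + μ ^ 2))⁻¹)
    (g' := fun r => r * (Real.sqrt (r ^ 2 + μ ^ 2))⁻¹ ^ 3)
    (fun r _ => (hasDerivAt_inv_sqrt (by positivity) r).neg.congr_deriv (by ring))
    (fun r hr => by
      have : 0 < r := hr
      positivity) hlim
  rw [h]
  simp [Real.sqrt_sq_eq_abs]

lemma integral_inv_sqrt_pow {μ : ℝ} (hμ : μ ≠ 0) :
    ∫ k : ℝ × ℝ, (Real.sqrt (k.1 ^ 2 + k.2 ^ 2 + μ ^ 2))⁻¹ ^ 3 = 2 * Real.pi * |μ|⁻¹ := by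
  rw [← integral_comp_polarCoord_symm]
  -- The factor 1 is the angular function, so that the integral splits as a product.
  have hsymm : ∀ p : ℝ × ℝ, p.1 • (Real.sqrt ((polarCoord.symm p).1 ^ 2 +
      (polarCoord.symm p).2 ^ 2 + μ ^ 2))⁻¹ ^ 3
      = (p.1 * (Real.sqrt (p.1 ^ 2 + μ ^ 2))⁻¹ ^ 3) * 1 := fun p => by
    have : (p.1 * Real.cos p.2) ^ 2 + (p.1 * Real.sin p.2) ^ 2 = p.1 ^ 2 := by
      rw [mul_pow, mul_pow, ← mul_add, Real.cos_sq_add_sin_sq, mul_one]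
    simp only [polarCoord_symm_apply, this, smul_eq_mul, mul_one]
  simp_rw [hsymm]
  rw [polarCoord_target, Measure.volume_eq_prod,
    setIntegral_prod_mul (fun r : ℝ => r * (Real.sqrt (r ^ 2 + μ ^ 2))⁻¹ ^ 3) (fun _ => (1 : ℝ)),
    integral_radial hμ]
  simp [Real.pi_pos.le]
  ring

lemma integral_curvature_bandProjection {μ : ℝ} (hμ : μ ≠ 0) :
    ∫ k : ℝ × ℝ, curvature (bandProjection μ) k
      = Real.pi * Complex.I * ((μ * |μ|⁻¹ : ℝ) : ℂ) := by
  simp_rw [curvature_bandProjection hμ]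
  rw [integral_const_mul, integral_complex_ofReal, integral_const_mul, integral_inv_sqrt_pow hμ]
  push_cast
  ring

lemma bulkIndex_eq_one {mMinus mPlus : ℝ} (hMinus : mMinus < 0) (hPlus : 0 < mPlus) :
    bulkIndex mMinus mPlus = 1 := by
  simp only [bulkIndex, chernNumber, blochProjection_chart_one, blochProjection_chart_neg_one]
  rw [integral_curvature_bandProjection hPlus.ne', integral_curvature_bandProjection hMinus.ne,
    abs_of_pos hPlus, abs_of_neg hMinus, inv_neg, mul_neg, mul_inv_cancel₀ hPlus.ne',
    mul_inv_cancel₀ hMinus.ne]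
  have hpi : (Real.pi : ℂ) ≠ 0 := by exact_mod_cast Real.pi_ne_zero
  have hI := Complex.I_ne_zero
  push_cast
  field_simp
  norm_num

end DiracInterface

end

/-! ### Assembly of the theorem -/

open DiracInterface in
theorem proposition2 (m : ℝ → ℝ) (mMinus mPlus ε : ℝ)
    (hm : ContDiff ℝ 1 m) (hm0 : m 0 = 0)
    (hbot : Tendsto m atBot (𝓝 mMinus)) (htop : Tendsto m atTop (𝓝 mPlus))
    (hMinus : mMinus ≠ 0) (hPlus : mPlus ≠ 0)
    (hmono : (∀ x, 0 ≤ deriv m x) ∨ (∀ x, deriv m x ≤ 0))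
    (hε : 0 < ε)
    (hgap : ∀ k, fermiLine mMinus mPlus ε k ∈ bulkGap mMinus mPlus k) :
    -- the bound-state energies are simple
    (∀ k ω ψ φ, IsBoundState m k ω ψ → IsBoundState m k ω φ → ∃ a : ℂ, φ = a • ψ) ∧
    -- every bound state belongs to exactly one edge channel
    (∀ k ω, (∃ ψ, IsBoundState m k ω ψ) → ∃! c : EdgeChannel m, k ∈ c.dom ∧ c.energy k = ω) ∧
    -- every edge channel meets the Fermi line in finitely many points
    (∀ c : EdgeChannel m, (c.meeting (fermiLine mMinus mPlus ε)).Finite) ∧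
    -- increasing mass
    ((∀ x, 0 ≤ deriv m x) →
      edgeIndex m mMinus mPlus ε = 1 ∧
      (∃ c : EdgeChannel m, c.dom = univ ∧ (∀ k, c.energy k = -k) ∧
        (∀ k ψ, IsBoundState m k (-k) ψ ↔ ∃ N : ℂ, N ≠ 0 ∧ ψ = N • psiL m) ∧
        intersectionNumber (fermiLine mMinus mPlus ε) c = -1 ∧
        ∀ c' : EdgeChannel m, c' ≠ c →
          intersectionNumber (fermiLine mMinus mPlus ε) c' = 0) ∧
      bulkIndex mMinus mPlus = 1 ∧
      bulkIndex mMinus mPlus = (edgeIndex m mMinus mPlus ε : ℂ)) ∧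
    -- decreasing mass
    ((∀ x, deriv m x ≤ 0) →
      edgeIndex m mMinus mPlus ε = -1 ∧
      (∃ c : EdgeChannel m, c.dom = univ ∧ (∀ k, c.energy k = k) ∧
        (∀ k ψ, IsBoundState m k k ψ ↔ ∃ N : ℂ, N ≠ 0 ∧ ψ = N • psiR m) ∧
        intersectionNumber (fermiLine mMinus mPlus ε) c = 1 ∧
        ∀ c' : EdgeChannel m, c' ≠ c →
          intersectionNumber (fermiLine mMinus mPlus ε) c' = 0)) := by
  have hcont : Continuous m := hm.continuous
  have hdiff : Differentiable ℝ m := hm.differentiable one_ne_zero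
  have kink_of_nonneg : (∀ x, 0 ≤ deriv m x) → IsKink m := fun h =>
    isKink_of_monotone hcont hm0 hbot htop hMinus hPlus (monotone_of_deriv_nonneg hdiff h)
  have kink_of_nonpos : (∀ x, deriv m x ≤ 0) → IsKink (-m) := fun h =>
    isKink_of_monotone hcont.neg (by simp [hm0]) hbot.neg htop.neg (neg_ne_zero.2 hMinus)
      (neg_ne_zero.2 hPlus) (antitone_of_deriv_nonpos hdiff h).neg
  -- Both signs of m' give spectral data of the same shape, enough for the claims that do not depend
  -- on the sign.
  obtain ⟨hbdd, s, S, h⟩ : (∃ C, 0 ≤ C ∧ ∀ x, |m x| ≤ C) ∧ ∃ s S, IsSpectralData m s S := by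
    rcases hmono with h | h
    · exact ⟨(kink_of_nonneg h).bounded, _, _, (kink_of_nonneg h).isSpectralData⟩
    · exact ⟨by simpa using (kink_of_nonpos h).bounded, _, _,
        (kink_of_nonpos h).isSpectralData_of_neg⟩
  refine ⟨fun k ω ψ φ hψ hφ => hψ.exists_eq_smul hbdd hφ, fun k ω hb => h.existsUnique_channel hb,
    h.finite_meeting mMinus mPlus hε, fun hinc => ?_, fun hdec => ?_⟩
  · have hk := kink_of_nonneg hinc
    have hs := hk.isSpectralData
    have hI : intersectionNumber (fermiLine mMinus mPlus ε) hs.chiralChannel = -1 :=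
      intersectionNumber_of_energy_eq_neg mMinus mPlus hε rfl neg_one_mul
    have hedge : edgeIndex m mMinus mPlus ε = 1 := by rw [hs.edgeIndex_eq, hI, neg_neg]
    have hmon := monotone_of_deriv_nonneg hdiff hinc
    have hbulk : bulkIndex mMinus mPlus = 1 := bulkIndex_eq_one
      (lt_of_le_of_ne (hm0 ▸ hmon.le_of_tendsto hbot 0) hMinus)
      (lt_of_le_of_ne (hm0 ▸ hmon.ge_of_tendsto htop 0) hPlus.symm)
    exact ⟨hedge, ⟨hs.chiralChannel, rfl, neg_one_mul, hk.isBoundState_iff_psiL, hI,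
      fun c' hc' => hs.intersectionNumber_eq_zero mMinus mPlus ε hc'⟩, hbulk,
      by rw [hbulk, hedge, Int.cast_one]⟩
  · have hk := kink_of_nonpos hdec
    have hs := hk.isSpectralData_of_neg
    have hI : intersectionNumber (fermiLine mMinus mPlus ε) hs.chiralChannel = 1 :=
      intersectionNumber_of_energy_eq_id mMinus mPlus hε rfl one_mul
    exact ⟨by rw [hs.edgeIndex_eq, hI], ⟨hs.chiralChannel, rfl, one_mul, hk.isBoundState_iff_psiR,
      hI, fun c' hc' => hs.intersectionNumber_eq_zero mMinus mPlus ε hc'⟩⟩
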